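/- **Setting.** Let $\Sigma$ be a compact smooth $n$-manifold with boundary ($n\ge 1$) with a smooth positive volume $d^nx$, let $z^A$ ($A$ in a finite index set) be smooth real fields on $\Sigma$, and let $\sigma^{AB}$ be a constant antisymmetric invertible matrix. *Local functions* are smooth functions of $t$, $x$ and finitely many derivatives of the fields at $x$; *functionals* are integrals over $\Sigma$ of local functions. For a functional $F$, $\delta F/\delta z^A$ is its Euler–Lagrange derivative, i.e. the local function with $\delta F=\int_\Sigma d^nx\,\frac{\delta F}{\delta z^A}\delta z^A$ for all $\delta z$ vanishing near $\partial\Sigma$; $\delta_F z^A=\sigma^{AB}\frac{\delta F}{\delta z^B}$ is the transformation generated by $F$, and $\{F,G\}=\int_\Sigma d^nx\,\frac{\delta F}{\delta z^A}\sigma^{AB}\frac{\delta G}{\delta z^B}$. The boundary conditions $\chi_I^\alpha(z)|_{\partial\Sigma}=\zeta^\alpha$ are given by local, time independent operators $\chi^\alpha_I$ and parametrized by sources $\zeta^\alpha$. With a Hamiltonian functional $H$, let $\delta_t=\partial_t+\delta_H$, let $d_t$ be the total time derivative, and let $\chi_E^{k,\alpha}=(d_t-\delta_t)^k\chi_I^\alpha$,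 $k>0$, as functions of the smooth histories $z(t,x)$. Let $C$ be the set of histories with $\chi_E^{k,\alpha}|_{\partial\Sigma}=0$ for all $k>0$ and $\alpha$. Assume that these external boundary conditions are regular: for $z\in C$, every smooth $w$ satisfying the linearized conditions $\delta_w\chi_E|_{\partial\Sigma}=0$ at $z$ is the velocity at $z$ of a smooth curve in $C$. A *variation* $\delta z$ is a smooth vector field on the space of histories (it maps smooth finite-dimensional families to smooth families). It *preserves the external boundary conditions* if $\delta\chi_E|_{\partial\Sigma}=0$ for all $z\in C$, and *preserves the internal boundary conditions* if moreover $\delta\chi_I^\alpha|_{\partial\Sigma}=0$ for all $z\in C$. A functional $G$ is *generalized differentiable* if, for all $z\in C$ and all variations $\delta$ preserving the internal boundary conditions, $$\delta G=\int_\Sigma d^nx\,\frac{\delta G}{\delta z^A}\delta z^A,\qquad \delta_G\chi_E|_{\partial\Sigma}=0,\qquad [\delta,\delta_G]\chi_I^\alpha|_{\partial\Sigma}=0 .$$ For a functional $F$, let $\oint_{\partial\Sigma}\Theta_F[\delta z]=\delta F-\int_\Sigma d^nx\,\frac{\delta F}{\delta z^A}\delta z^A$ be the boundary term of its variation, and let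 $$\{F,G\}_\zeta=\{F,G\}+\oint_{\partial\Sigma}\Theta_F[\delta_G z]-\oint_{\partial\Sigma}\Theta_G[\delta_F z].$$ **Theorem.** The modified bracket is a well-defined Poisson bracket on generalized differentiable functionals: 1. if $F$ is generalized differentiable, then on $C$ the boundary term $\oint\Theta_F[\delta z]$ of a variation $\delta$ preserving the external boundary conditions depends on $\delta$ only through the variation $\delta\zeta^\alpha=\delta\chi^\alpha_I|_{\partial\Sigma}$ of the sources (so it may be written $\oint\Theta_F[\delta\zeta]$, and $\{F,G\}_\zeta=\{F,G\}+\oint\Theta_F[\delta_G\zeta]-\oint\Theta_G[\delta_F\zeta]$); 2. if $F$ and $G$ are generalized differentiable, so is $\{F,G\}_\zeta$; 3. generalized differentiable functionals form a real vector space on which $\{\cdot,\cdot\}_\zeta$ is bilinear and antisymmetric, $\{F,G\}_\zeta=-\{G,F\}_\zeta$; 4. it satisfies the Jacobi identity $\{F,\{G,K\}_\zeta\}_\zeta+\{G,\{K,F\}_\zeta\}_\zeta+\{K,\{F,G\}_\zeta\}_\zeta=0$. The identities in 3 and 4 hold at every time $t$ and every smooth field configuration $z$. -/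

import Mathlib

open scoped Manifold ContDiff Topology Matrix
open MeasureTheory

noncomputable section

namespace BoundaryPoisson

/-! ### Field configurations and local functions -/

/-- A configuration `z^A(x)` of the canonical fields at a fixed time, `A ∈ ι`. -/
abbrev Config (M ι : Type*) := M → ι → ℝ

/-- A history `z^A(t, x)` of the canonical fields. -/
abbrev History (M ι : Type*) := ℝ → M → ι → ℝ

section Local

variable (n : ℕ) [NeZero n] {M : Type*} [TopologicalSpace M]
  [ChartedSpace (EuclideanHalfSpace n) M] {ι : Type*} [Fintype ι]

/-- Smoothness (up to the boundary) of a configuration. -/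
def SmoothConfig (z : Config M ι) : Prop :=
  ContMDiff (𝓡∂ n) 𝓘(ℝ, ι → ℝ) ∞ z

/-- Joint smoothness in `(t, x)` of a history. -/
def SmoothHistory (z : History M ι) : Prop :=
  ContMDiff (𝓘(ℝ, ℝ).prod (𝓡∂ n)) 𝓘(ℝ, ι → ℝ) ∞ (fun q : ℝ × M => z q.1 q.2)

/-- Joint smoothness in `(s, t, x)` of a family of histories with parameter `s` in a normed
space. -/
def SmoothFamily {P : Type*} [NormedAddCommGroup P] [NormedSpace ℝ P]
    (c : P → History M ι) : Prop :=
  ContMDiff (𝓘(ℝ, P).prod (𝓘(ℝ, ℝ).prod (𝓡∂ n))) 𝓘(ℝ, ι → ℝ) ∞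
    (fun q : P × (ℝ × M) => c q.1 q.2.1 q.2.2)

/-- A variation `z ↦ δz`, i.e. a vector field on the space of histories, is smooth if it sends
smooth finite dimensional families of histories to such families. -/
def SmoothVariation (δ : History M ι → History M ι) : Prop :=
  ∀ (p : ℕ) (c : (Fin p → ℝ) → History M ι), SmoothFamily n c → SmoothFamily n (fun s => δ (c s))

/-- Smooth vector fields on `M`. -/
abbrev VecField (M : Type*) [TopologicalSpace M] [ChartedSpace (EuclideanHalfSpace n) M]
    [IsManifold (𝓡∂ n) ∞ M] :=
  ContMDiffSection (𝓡∂ n) (EuclideanSpace ℝ (Fin n)) ∞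
    (TangentSpace (𝓡∂ n) : M → Type)

variable {n} [IsManifold (𝓡∂ n) ∞ M]

/-- The derivative of `f` along a vector field. -/
def lieD (X : VecField n M) (f : Config M ι) : Config M ι :=
  fun x => mfderiv (𝓡∂ n) 𝓘(ℝ, ι → ℝ) f x (X x)

/-- The iterated derivative `X₁ (X₂ (⋯ (X_k f)))`. -/
def iterD : List (VecField n M) → Config M ι → Config M ι
  | [], f => f
  | X :: l, f => lieD X (iterD l f)

variable (n)

/-- Local functions: `f(t, x, [z])` is a smooth function of `t`, `x` and of finitely many
(iterated) derivatives of the fields at `x`. -/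
def IsLocalOp {W : Type*} [NormedAddCommGroup W] [NormedSpace ℝ W]
    (f : ℝ → Config M ι → M → W) : Prop :=
  ∃ (N : ℕ) (D : Fin N → List (VecField n M)) (L : ℝ × (M × (Fin N → ι → ℝ)) → W),
    ContMDiff (𝓘(ℝ, ℝ).prod ((𝓡∂ n).prod 𝓘(ℝ, Fin N → ι → ℝ))) 𝓘(ℝ, W) ∞ L ∧
    ∀ (t : ℝ) (z : Config M ι), SmoothConfig n z →
      ∀ x, f t z x = L (t, x, fun j => iterD (D j) z x)

variable [MeasurableSpace M]

/-- `μ` is a volume `ρ(x) dⁿx`: in each chart it has a smooth positive density with respect to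
Lebesgue measure. -/
def IsSmoothVolume (μ : Measure M) : Prop :=
  ∀ p : M, ∃ ρ : EuclideanSpace ℝ (Fin n) → ℝ,
    ContDiffOn ℝ ∞ ρ (extChartAt (𝓡∂ n) p).target ∧
    (∀ y ∈ (extChartAt (𝓡∂ n) p).target, 0 < ρ y) ∧
    (μ.restrict (extChartAt (𝓡∂ n) p).source).map (extChartAt (𝓡∂ n) p) =
      (volume.restrict (extChartAt (𝓡∂ n) p).target).withDensity (fun y => ENNReal.ofReal (ρ y))

/-- A (possibly explicitly time dependent) local functional `F = ∫_Σ f(t, x, [z])`. By Stokes'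
theorem boundary integrals of local functions are of this form. -/
def IsLocalFunctional (μ : Measure M) (F : ℝ → Config M ι → ℝ) : Prop :=
  ∃ f : ℝ → Config M ι → M → ℝ, IsLocalOp n f ∧
    ∀ (t : ℝ) (z : Config M ι), SmoothConfig n z → F t z = ∫ x, f t z x ∂μ

/-- The first variation `δF` of a functional at `z`, for the variation `v` of the fields. -/
def firstVar (F : Config M ι → ℝ) (z v : Config M ι) : ℝ :=
  deriv (fun s : ℝ => F (z + s • v)) 0

/-- `∫_Σ u_A v^A`. -/
def pairing (μ : Measure M) (u v : Config M ι) : ℝ :=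
  ∫ x, u x ⬝ᵥ v x ∂μ

/-- `v` is zero in a neighbourhood of the boundary. -/
def VanishesNearBoundary (v : Config M ι) : Prop :=
  ∀ x ∈ (𝓡∂ n).boundary M, ∀ᶠ y in 𝓝 x, v y = 0

/-- `E` is the variational (Euler–Lagrange) derivative of `F`: it is a local function, and
`δF = ∫_Σ E_A δz^A` for all variations vanishing near the boundary. -/
def IsVarDeriv (μ : Measure M) (F : ℝ → Config M ι → ℝ) (E : ℝ → Config M ι → Config M ι) : Prop :=
  IsLocalOp n (fun t z x => E t z x) ∧
  ∀ (t : ℝ) (z v : Config M ι), SmoothConfig n z → SmoothConfig n v → VanishesNearBoundary n v →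
    firstVar (F t) z v = pairing μ (E t z) v

open Classical in
/-- The variational derivative `δF/δz^A` (on smooth configurations there is at most one). -/
def varDeriv (μ : Measure M) (F : ℝ → Config M ι → ℝ) : ℝ → Config M ι → Config M ι :=
  if h : ∃ E, IsVarDeriv n μ F E then h.choose else 0

end Local

/-! ### Functions of the histories -/

section Histories

variable {M ι : Type*}

/-- The derivative `δA` of a function `A(t, x, [z])` of the histories, for the variation `δ`. -/
def varObs (δ : History M ι → History M ι) (A : History M ι → ℝ → M → ℝ) :
    History M ι → ℝ → M → ℝ :=
  fun z t x => deriv (fun s : ℝ => A (z + s • δ z) t x) 0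

/-- The total time derivative `d_t A`. -/
def totalTime (A : History M ι → ℝ → M → ℝ) : History M ι → ℝ → M → ℝ :=
  fun z t x => deriv (fun s : ℝ => A z s x) t

/-- The partial derivative `∂A/∂t`, hitting the explicit dependence in `t` only: in
`A (z(· - s)) (t + s)` the fields and their time derivatives are those of `z` at time `t`, for
all `s`. -/
def partialTime (A : History M ι → ℝ → M → ℝ) : History M ι → ℝ → M → ℝ :=
  fun z t x => deriv (fun s : ℝ => A (fun r => z (r - s)) (t + s) x) 0

end Histories

/-! ### Hamiltonian field theories with boundary conditions -/

/-- A Hamiltonian field theory on the manifold with boundary `M`, with fields `z^A`, `A ∈ ι`, and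
boundary operators `χ_I^α`, `α ∈ κ`. -/
structure FieldTheory (n : ℕ) [NeZero n] (M : Type*) [TopologicalSpace M]
    [ChartedSpace (EuclideanHalfSpace n) M] [IsManifold (𝓡∂ n) ∞ M] [MeasurableSpace M]
    (ι : Type*) [Fintype ι] [DecidableEq ι] (κ : Type*) where
  /-- the volume `dⁿx` -/
  vol : Measure M
  smooth_vol : IsSmoothVolume n vol
  /-- the constant matrix `σ^{AB}` -/
  σ : Matrix ι ι ℝ
  σ_antisymm : σᵀ = -σ
  σ_invertible : IsUnit σ.det
  /-- the operators `χ_I^α` of the internal boundary conditions `χ_I^α(z)|_{∂Σ} = ζ^α` -/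
  χ : κ → Config M ι → M → ℝ
  χ_local : ∀ α, IsLocalOp n (fun _ z x => χ α z x)
  /-- the Hamiltonian -/
  H : ℝ → Config M ι → ℝ
  H_local : IsLocalFunctional n vol H

namespace FieldTheory

variable {n : ℕ} [NeZero n] {M : Type*} [TopologicalSpace M]
  [ChartedSpace (EuclideanHalfSpace n) M] [IsManifold (𝓡∂ n) ∞ M] [MeasurableSpace M]
  {ι : Type*} [Fintype ι] [DecidableEq ι] {κ : Type*} (T : FieldTheory n M ι κ)

/-- The transformation `δ_G z^A = σ^{AB} δG/δz^B` generated by `G`. -/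
def ham (G : ℝ → Config M ι → ℝ) : ℝ → Config M ι → Config M ι :=
  fun t z x => T.σ *ᵥ varDeriv n T.vol G t z x

/-- The transformation generated by `G`, acting on histories. -/
def hamHist (G : ℝ → Config M ι → ℝ) : History M ι → History M ι :=
  fun z t => T.ham G t (z t)

/-- `δ_t = ∂/∂t + δ_H`. -/
def dynTime (A : History M ι → ℝ → M → ℝ) : History M ι → ℝ → M → ℝ :=
  partialTime A + varObs (T.hamHist T.H) A

/-- `χ_I^α`, as a function of the histories. -/
def chiI (α : κ) : History M ι → ℝ → M → ℝ :=
  fun z t x => T.χ α (z t) x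

/-- `χ_E^{k,α} = (d_t - δ_t)^k χ_I^α`. -/
def chiE (α : κ) : ℕ → History M ι → ℝ → M → ℝ
  | 0 => T.chiI α
  | k + 1 => totalTime (chiE α k) - T.dynTime (chiE α k)

/-- The histories satisfying the external boundary conditions `χ_E^{k,α}|_{∂Σ} = 0`, `k > 0`. -/
def Allowed (z : History M ι) : Prop :=
  SmoothHistory n z ∧ ∀ k > 0, ∀ α, ∀ t, ∀ x ∈ (𝓡∂ n).boundary M, T.chiE α k z t x = 0

/-- `δχ_E|_{∂Σ} = 0` for all `z` with `χ_E|_{∂Σ} = 0`. -/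
def PreservesExternal (δ : History M ι → History M ι) : Prop :=
  ∀ z, T.Allowed z → ∀ k > 0, ∀ α, ∀ t, ∀ x ∈ (𝓡∂ n).boundary M,
    varObs δ (T.chiE α k) z t x = 0

/-- `δχ_I|_{∂Σ} = 0` and `δχ_E|_{∂Σ} = 0` for all `z` with `χ_E|_{∂Σ} = 0`. -/
def PreservesInternal (δ : History M ι → History M ι) : Prop :=
  T.PreservesExternal δ ∧
  ∀ z, T.Allowed z → ∀ α, ∀ t, ∀ x ∈ (𝓡∂ n).boundary M, varObs δ (T.chiI α) z t x = 0

/-- The external boundary conditions are regular: at each `z` with `χ_E|_{∂Σ} = 0`, each `w`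
satisfying the linearized conditions `δ_w χ_E|_{∂Σ} = 0` is tangent to a smooth curve of histories
with `χ_E|_{∂Σ} = 0`. -/
def RegularExternal : Prop :=
  ∀ z, T.Allowed z → ∀ w : History M ι, SmoothHistory n w →
    (∀ k > 0, ∀ α, ∀ t, ∀ x ∈ (𝓡∂ n).boundary M,
      varObs (fun _ => w) (T.chiE α k) z t x = 0) →
    ∃ c : ℝ → History M ι, SmoothFamily n c ∧ c 0 = z ∧ (∀ s, T.Allowed (c s)) ∧
      ∀ t x, deriv (fun s => c s t x) 0 = w t x

/-- Generalized differentiable functionals. -/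
structure GenDiff (G : ℝ → Config M ι → ℝ) : Prop where
  isLocal : IsLocalFunctional n T.vol G
  hasVarDeriv : ∃ E, IsVarDeriv n T.vol G E
  /-- `δG = ∫_Σ δG/δz^A δz^A` for all variations preserving the internal boundary conditions -/
  variation : ∀ δ, SmoothVariation n δ → T.PreservesInternal δ → ∀ z, T.Allowed z → ∀ t,
    firstVar (G t) (z t) (δ z t) = pairing T.vol (varDeriv n T.vol G t (z t)) (δ z t)
  /-- `δ_G χ_E|_{∂Σ} = 0` -/
  preservesExternal : T.PreservesExternal (T.hamHist G)
  /-- `[δ, δ_G] χ_I|_{∂Σ} = 0` for all variations preserving the internal boundary conditions -/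
  commutator : ∀ δ, SmoothVariation n δ → T.PreservesInternal δ → ∀ z, T.Allowed z →
    ∀ α, ∀ t, ∀ x ∈ (𝓡∂ n).boundary M,
      varObs δ (varObs (T.hamHist G) (T.chiI α)) z t x
        - varObs (T.hamHist G) (varObs δ (T.chiI α)) z t x = 0

/-- The Poisson bracket `{F, G} = ∫_Σ δF/δz^A σ^{AB} δG/δz^B`. -/
def poisson (F G : ℝ → Config M ι → ℝ) : ℝ → Config M ι → ℝ :=
  fun t z => pairing T.vol (varDeriv n T.vol F t z) (T.ham G t z)

/-- The boundary term `∮_{∂Σ} Θ_F[δz]` of the variation of `F`, defined by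
`δF = ∫_Σ δF/δz^A δz^A + ∮_{∂Σ} Θ_F[δz]`. -/
def boundaryTerm (F : ℝ → Config M ι → ℝ) (t : ℝ) (z v : Config M ι) : ℝ :=
  firstVar (F t) z v - pairing T.vol (varDeriv n T.vol F t z) v

/-- The modified bracket
`{F, G}_ζ = {F, G} + ∮_{∂Σ} Θ_F[δ_G ζ] - ∮_{∂Σ} Θ_G[δ_F ζ]`. -/
def modBracket (F G : ℝ → Config M ι → ℝ) : ℝ → Config M ι → ℝ :=
  fun t z => T.poisson F G t z + T.boundaryTerm F t z (T.ham G t z)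
    - T.boundaryTerm G t z (T.ham F t z)

end FieldTheory

end BoundaryPoisson

end

/-! Write E_F for the variational derivative, X_F = σ E_F for the vector field generated by F, and
⟨u, v⟩ for the integral of u · v. Antisymmetry of σ turns the modified bracket into X_G F - X_F G -
⟨E_F, X_G⟩ (`modBracket_eq`), so no boundary term ever has to be computed and no integration by
parts is needed.

The central computation (`lie_lie_atTime`) commutes a variation δ past a vector field U: δ U F = U δ
F + [δ, U] F. If δF = ⟨E_F, δz⟩ may be differentiated along U at z, and the same formula holds at z
for [δ, U], the Leibniz rule leaves ⟨U E_F, δz⟩ + ⟨E_F, δ(U z)⟩. Using this twice, with σ constant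
and antisymmetric, gives δ{F, G}_ζ = ⟨X_G E_F - X_F E_G, δz⟩ (`firstVar_modBracket`). It is used in
two situations:

For constant δ vanishing near the boundary the assumptions hold at every smooth z, because local
operators preserve supports. This identifies the variational derivative of the bracket, hence
X_{{F,G}} = [X_G, X_F] (`hamHist_modBracket`). The Jacobi identity is then an algebraic
cancellation, free of boundary conditions.

For δ preserving the internal boundary conditions, the assumptions are needed on C only. Regularity
makes every X_G tangent to C, so identities on C can be differentiated along X_G
(`RegularExternal.lie_congr`); the commutator condition says that [δ, X_G] again preserves the
internal conditions (`PreservesInternal.bracket`). Together with the Jacobi identity for vector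
fields this gives closure under the bracket. Dependence on the sources alone holds because the
difference of two variations with equal δζ preserves the internal conditions.

All this rests on a calculus on the space of histories in which smoothness is tested on finite
dimensional families. Hadamard's lemma (`SmoothFamily.exists_slope`) shows that derivatives along
curves depend on velocities only, and this makes commutators of derivations derivations along
brackets (`SmoothFun.lie_bracket`). The fundamental lemma of the calculus of variations makes
variational derivatives unique. -/

noncomputable section

set_option linter.unusedSectionVars false

namespace BoundaryPoisson

/-! ### Smooth dependence of derivatives on parameters, on manifolds with boundary. -/

section Calculus

variable {E : Type*} [NormedAddCommGroup E] [NormedSpace ℝ E] {H : Type*} [TopologicalSpace H]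
  {I : ModelWithCorners ℝ E H} {M : Type*} [TopologicalSpace M] [ChartedSpace H M]
  {F : Type*} [NormedAddCommGroup F] [NormedSpace ℝ F] {K : Type*} [TopologicalSpace K]
  {J : ModelWithCorners ℝ F K} {N : Type*} [TopologicalSpace N] [ChartedSpace K N]
  {P : Type*} [NormedAddCommGroup P] [NormedSpace ℝ P]
  {W : Type*} [NormedAddCommGroup W] [NormedSpace ℝ W]

/-- The partial Fréchet derivative of a smooth function in a vector variable is smooth. -/
theorem contMDiff_fderiv_param [IsManifold J ∞ N] {g : N → P → W} {r : N → P}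
    (hg : ContMDiff (J.prod 𝓘(ℝ, P)) 𝓘(ℝ, W) ∞ (Function.uncurry g))
    (hr : ContMDiff J 𝓘(ℝ, P) ∞ r) :
    ContMDiff J 𝓘(ℝ, P →L[ℝ] W) ∞ (fun q => fderiv ℝ (g q) (r q)) := by
  have : IsManifold J 1 N := IsManifold.of_le (n := ∞) (by exact_mod_cast le_top)
  intro q
  have := ContMDiffAt.mfderiv (m := ∞) (n := ∞) g r (hg (q, r q)) (hr q) (by simp)
  -- Smoothness of `mfderiv` is expressed in tangent coordinates, which are trivial between vector
  -- spaces.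
  have e := inTangentCoordinates_model_space (I := 𝓘(ℝ, P)) (I' := 𝓘(ℝ, W)) r
    (fun x => g x (r x)) (fun x => fderiv ℝ (g x) (r x)) q
  simp only [mfderiv_eq_fderiv] at this
  exact e ▸ this

/-- The partial derivative of a smooth function in a real variable is smooth. -/
theorem contMDiff_deriv_param [IsManifold J ∞ N] {g : N → ℝ → W} {r : N → ℝ}
    (hg : ContMDiff (J.prod 𝓘(ℝ, ℝ)) 𝓘(ℝ, W) ∞ (Function.uncurry g))
    (hr : ContMDiff J 𝓘(ℝ, ℝ) ∞ r) :
    ContMDiff J 𝓘(ℝ, W) ∞ (fun q => deriv (g q) (r q)) := by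
  have := (contMDiff_fderiv_param hg hr).clm_apply (contMDiff_const (c := (1 : ℝ)))
  simpa only [fderiv_apply_one_eq_deriv] using this

variable (I) in
/-- The derivative of a vector valued function at a point of a manifold, in a given direction. -/
def dirDeriv (f : M → W) (x : M) (w : E) : W := mfderiv I 𝓘(ℝ, W) f x w

/-- The derivative of a smooth function along a vector field, with smooth parameters, is smooth. -/
theorem contMDiff_dirDeriv_param [IsManifold J ∞ N] [IsManifold I ∞ M] {g : N → M → W} {r : N → M}
    (hg : ContMDiff (J.prod I) 𝓘(ℝ, W) ∞ (Function.uncurry g)) (hr : ContMDiff J I ∞ r)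
    (X : ContMDiffSection I E ∞ (TangentSpace I : M → Type _)) :
    ContMDiff J 𝓘(ℝ, W) ∞ (fun q => dirDeriv I (g q) (r q) (X (r q))) := by
  have : IsManifold J 1 N := IsManifold.of_le (n := ∞) (by exact_mod_cast le_top)
  have : IsManifold I 1 M := IsManifold.of_le (n := ∞) (by exact_mod_cast le_top)
  intro q
  have h1 := ContMDiffAt.mfderiv (m := ∞) (n := ∞) g r (hg (q, r q)) (hr q) (by simp)
  have hX : ContMDiffAt J I.tangent ∞ (fun q => (⟨r q, X (r q)⟩ : TangentBundle I M)) q :=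
    (X.contMDiff.comp hr) q
  have hb : ContMDiffAt J 𝓘(ℝ, W) ∞ (fun q => g q (r q)) q :=
    (hg.comp (contMDiff_id.prodMk hr)) q
  have h2 := ContMDiffAt.clm_apply_of_inCoordinates (b₁ := r) (b₂ := fun q => g q (r q))
    (E₁ := TangentSpace I) (E₂ := TangentSpace 𝓘(ℝ, W)) h1 hX hb
  exact (contMDiff_snd_tangentBundle_modelSpace W 𝓘(ℝ, W)).contMDiffAt.comp q h2


/-- Chain rule along the graph of `a`: an explicit derivative in x plus one through the fields. This
is the total derivative formula behind the locality of derivatives of local functions. -/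
theorem dirDeriv_graph {V : Type*} [NormedAddCommGroup V] [NormedSpace ℝ V] {ℓ : M × V → W}
    (hℓ : ContMDiff (I.prod 𝓘(ℝ, V)) 𝓘(ℝ, W) ∞ ℓ) {a : M → V} (ha : ContMDiff I 𝓘(ℝ, V) ∞ a)
    (x : M) (w : E) :
    dirDeriv I (fun x => ℓ (x, a x)) x w = dirDeriv I (fun x' => ℓ (x', a x)) x w +
        fderiv ℝ (fun b => ℓ (x, b)) (a x) (dirDeriv I a x w) := by
  have ha' : MDifferentiableAt I 𝓘(ℝ, V) a x := (ha x).mdifferentiableAt (by simp)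
  have hℓ' : MDifferentiableAt (I.prod 𝓘(ℝ, V)) 𝓘(ℝ, W) ℓ (x, a x) :=
    (hℓ _).mdifferentiableAt (by simp)
  have h1 := mfderiv_comp_apply (I' := I.prod 𝓘(ℝ, V)) (f := fun x => (x, a x)) x hℓ'
    (mdifferentiableAt_id.prodMk ha') w
  have h2 := MDifferentiableAt.mfderiv_prod (I := I) (I' := I) (I'' := 𝓘(ℝ, V)) (f := id)
    (mdifferentiableAt_id (x := x)) ha'
  have h3 := mfderiv_prod_eq_add_apply (f := ℓ) (p := (x, a x))
    (v := (w, dirDeriv I a x w)) hℓ'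
  have h4 : mfderiv I (I.prod 𝓘(ℝ, V)) (fun x => (x, a x)) x w = (w, dirDeriv I a x w) := by
    rw [mfderiv_id] at h2
    exact DFunLike.congr_fun h2 w
  have h5 : dirDeriv 𝓘(ℝ, V) (fun b => ℓ (x, b)) (a x) (dirDeriv I a x w) =
      fderiv ℝ (fun b => ℓ (x, b)) (a x) (dirDeriv I a x w) :=
    DFunLike.congr_fun mfderiv_eq_fderiv (dirDeriv I a x w)
  rw [← h5]
  exact h1.trans ((congrArg (mfderiv (I.prod 𝓘(ℝ, V)) 𝓘(ℝ, W) ℓ (x, a x)) h4).trans h3)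

theorem dirDeriv_pi {A : Type*} [Fintype A] {a : M → A → W}
    (ha : ContMDiff I 𝓘(ℝ, A → W) ∞ a) (x : M) (w : E) (j : A) :
    dirDeriv I a x w j = dirDeriv I (fun x => a x j) x w := by
  have ha' : MDifferentiableAt I 𝓘(ℝ, A → W) a x := (ha x).mdifferentiableAt (by simp)
  set p : (A → W) →L[ℝ] W := ContinuousLinearMap.proj j
  have h1 := mfderiv_comp_apply (I' := 𝓘(ℝ, A → W)) (I'' := 𝓘(ℝ, W)) (f := a) (g := p) x
    p.differentiableAt.mdifferentiableAt ha' w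
  have h2 : dirDeriv 𝓘(ℝ, A → W) p (a x) (dirDeriv I a x w) = p (dirDeriv I a x w) :=
    (DFunLike.congr_fun mfderiv_eq_fderiv (dirDeriv I a x w)).trans
      (DFunLike.congr_fun p.fderiv (dirDeriv I a x w))
  exact (h1.trans h2).symm

end Calculus

/-! ### Smoothness of integrals over compact sets in their parameters. -/

section ParametricIntegral

variable {E : Type} [NormedAddCommGroup E] [NormedSpace ℝ E] {H : Type*} [TopologicalSpace H]
  {I : ModelWithCorners ℝ E H} {Q : Type*} [TopologicalSpace Q] [ChartedSpace H Q]
  {F : Type*} [NormedAddCommGroup F] [NormedSpace ℝ F] {G : Type*} [TopologicalSpace G]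
  {J : ModelWithCorners ℝ F G} {K : Type*} [TopologicalSpace K] [ChartedSpace G K]
  [MeasurableSpace K] [OpensMeasurableSpace K] [T2Space K]
  {μ : Measure K} [IsFiniteMeasureOnCompacts μ] {K₀ : Set K}

/-- Differentiation under the integral over a compact set, on a convex set of parameters. -/
theorem hasFDerivWithinAt_setIntegral {W : Type*} [NormedAddCommGroup W] [NormedSpace ℝ W]
    (hK : IsCompact K₀) {S : Set E} (hS : Convex ℝ S)
    {f : E → K → W} {f' : E → K → E →L[ℝ] W}
    (hf : ContinuousOn (Function.uncurry f) (S ×ˢ Set.univ))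
    (hf' : ContinuousOn (Function.uncurry f') (S ×ˢ Set.univ))
    (hd : ∀ y ∈ S, ∀ k, HasFDerivWithinAt (fun y => f y k) (f' y k) S y) {y : E} (hy : y ∈ S) :
    HasFDerivWithinAt (fun y => ∫ k in K₀, f y k ∂μ) (∫ k in K₀, f' y k ∂μ) S y := by
  have hc : ∀ y ∈ S, Continuous (f y) := fun y hy => by
    rw [← continuousOn_univ]
    exact hf.comp (f := fun k => (y, k)) (by fun_prop) (fun k _ => ⟨hy, trivial⟩)
  have hc' : ∀ y ∈ S, Continuous (f' y) := fun y hy => by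
    rw [← continuousOn_univ]
    exact hf'.comp (f := fun k => (y, k)) (by fun_prop) (fun k _ => ⟨hy, trivial⟩)
  have hi : ∀ y ∈ S, IntegrableOn (f y) K₀ μ := fun y hy =>
    (hc y hy).continuousOn.integrableOn_compact hK
  have hi' : ∀ y ∈ S, IntegrableOn (f' y) K₀ μ := fun y hy =>
    (hc' y hy).continuousOn.integrableOn_compact hK
  have hfin : μ K₀ < ⊤ := hK.measure_lt_top
  have : IsFiniteMeasure (μ.restrict K₀) := ⟨by simpa using hfin⟩
  rw [hasFDerivWithinAt_iff_isLittleO, Asymptotics.isLittleO_iff]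
  intro ε hε
  -- The summand 1 keeps the divisor positive when `K₀` is a null set.
  set c := μ.real K₀ + 1 with hcdef
  have hcpos : 0 < c := by positivity
  -- Compactness makes `f'` close to its value at `y` uniformly in k; the mean value inequality on
  -- the convex set ball ∩ `S` then bounds the remainder uniformly.
  obtain ⟨v, hv, hv'⟩ := hK.mem_uniformity_of_prod (f := f') (s := S) (q := y)
    (hf'.mono (Set.prod_mono_right (Set.subset_univ _))) hy
    (Metric.dist_mem_uniformity (div_pos hε hcpos))
  obtain ⟨δ, hδ, hb⟩ := Metric.mem_nhdsWithin_iff.1 hv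
  have hB : Convex ℝ (Metric.ball y δ ∩ S) := (convex_ball y δ).inter hS
  filter_upwards [inter_mem_nhdsWithin S (Metric.ball_mem_nhds y hδ)] with z hz
  have key : ∀ k ∈ K₀, ‖f z k - f y k - f' y k (z - y)‖ ≤ ε / c * ‖z - y‖ := by
    intro k hk
    refine hB.norm_image_sub_le_of_norm_hasFDerivWithin_le' (f := fun y => f y k)
      (f' := fun y => f' y k) (fun x hx => (hd x hx.2 k).mono Set.inter_subset_right) ?_
      ⟨Metric.mem_ball_self hδ, hy⟩ ⟨hz.2, hz.1⟩
    intro x hx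
    have := hv' x (hb hx) k hk
    rw [← dist_eq_norm]
    exact le_of_lt this
  have e : (∫ k in K₀, f z k ∂μ) - (∫ k in K₀, f y k ∂μ) - (∫ k in K₀, f' y k ∂μ) (z - y) =
      ∫ k in K₀, (f z k - f y k - f' y k (z - y)) ∂μ := by
    rw [ContinuousLinearMap.integral_apply (hi' y hy), integral_sub, integral_sub]
    · exact hi z hz.1
    · exact hi y hy
    · exact (hi z hz.1).sub (hi y hy)
    · exact (hi' y hy).apply_continuousLinearMap _
  rw [e]
  calc ‖∫ k in K₀, (f z k - f y k - f' y k (z - y)) ∂μ‖ ≤ ε / c * ‖z - y‖ * μ.real K₀ :=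
        norm_setIntegral_le_of_norm_le_const hfin key
    _ ≤ ε / c * ‖z - y‖ * c := by gcongr; simp [hcdef]
    _ = ε * ‖z - y‖ := by field_simp

/-- Induction on the order: the derivative of the integral is the integral of a function of the same
kind, valued in `E →L[ℝ] W`. So `W` must vary in the induction, and `E : Type` keeps `E →L[ℝ] W` in
the universe of `W`. Derivatives within `S` allow parameters on a manifold with boundary. -/
theorem contDiffOn_setIntegral [IsManifold J ∞ K] (hK : IsCompact K₀) {S : Set E}
    (hS : Convex ℝ S) (hS' : UniqueDiffOn ℝ S) (m : ℕ) :
    ∀ {W : Type*} [NormedAddCommGroup W] [NormedSpace ℝ W] {f : E → K → W},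
      ContMDiffOn (𝓘(ℝ, E).prod J) 𝓘(ℝ, W) ∞ (Function.uncurry f) (S ×ˢ Set.univ) →
      ContDiffOn ℝ m (fun y => ∫ k in K₀, f y k ∂μ) S := by
  have key : ∀ {W : Type _} [NormedAddCommGroup W] [NormedSpace ℝ W] {f : E → K → W},
      ContMDiffOn (𝓘(ℝ, E).prod J) 𝓘(ℝ, W) ∞ (Function.uncurry f) (S ×ˢ Set.univ) →
      ContMDiffOn (𝓘(ℝ, E).prod J) 𝓘(ℝ, E →L[ℝ] W) ∞
        (Function.uncurry fun y k => fderivWithin ℝ (fun y => f y k) S y) (S ×ˢ Set.univ) ∧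
      ∀ y ∈ S, HasFDerivWithinAt (fun y => ∫ k in K₀, f y k ∂μ)
        (∫ k in K₀, fderivWithin ℝ (fun y => f y k) S y ∂μ) S y := by
    intro W _ _ f hf
    have hsm : ContMDiffOn (𝓘(ℝ, E).prod J) 𝓘(ℝ, E →L[ℝ] W) ∞
        (Function.uncurry fun y k => fderivWithin ℝ (fun y => f y k) S y) (S ×ˢ Set.univ) := by
      have : IsManifold J 1 K := IsManifold.of_le (n := ∞) (by exact_mod_cast le_top)
      rintro ⟨y, k⟩ hq
      have hf2 : ContMDiffOn ((𝓘(ℝ, E).prod J).prod 𝓘(ℝ, E)) 𝓘(ℝ, W) ∞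
          (Function.uncurry fun (q : E × K) y => f y q.2) ((S ×ˢ Set.univ) ×ˢ S) :=
        hf.comp (f := fun p : (E × K) × E => (p.2, p.1.2))
          (contMDiff_snd.prodMk (contMDiff_snd.comp contMDiff_fst)).contMDiffOn
          (fun p hp => ⟨hp.2, trivial⟩)
      have h := ContMDiffWithinAt.mfderivWithin (m := ∞) (n := ∞) (I := 𝓘(ℝ, E))
        (I' := 𝓘(ℝ, W)) (J := 𝓘(ℝ, E).prod J) (x₀ := (y, k)) (t := S ×ˢ (Set.univ : Set K))
        (u := S) (f := fun q y => f y q.2) (g := Prod.fst) (hf2 ((y, k), y) ⟨hq, hq.1⟩)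
        contMDiffWithinAt_fst hq (fun p hp => hp.1) (by simp) hS'.uniqueMDiffOn
      have e := inTangentCoordinates_model_space (I := 𝓘(ℝ, E)) (I' := 𝓘(ℝ, W))
        (Prod.fst : E × K → E) (fun q => f q.1 q.2)
        (fun q => fderivWithin ℝ (fun y => f y q.2) S q.1) (y, k)
      simp only [mfderivWithin_eq_fderivWithin] at h
      rw [e] at h
      exact h
    refine ⟨hsm, fun y hy => hasFDerivWithinAt_setIntegral hK hS hf.continuousOn hsm.continuousOn
      (fun y hy k => ?_) hy⟩
    have : ContMDiffOn 𝓘(ℝ, E) 𝓘(ℝ, W) ∞ (fun y => f y k) S :=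
      hf.comp (f := fun y => (y, k)) (contMDiffOn_id.prodMk contMDiffOn_const)
        (fun y hy => ⟨hy, trivial⟩)
    exact (this.contDiffOn.differentiableOn (by simp) y hy).hasFDerivWithinAt
  induction m with
  | zero =>
    intro W _ _ f hf
    rw [Nat.cast_zero, contDiffOn_zero]
    exact fun y hy => ((key hf).2 y hy).continuousWithinAt
  | succ m ih =>
    intro W _ _ f hf
    obtain ⟨h1, h2⟩ := key hf
    push_cast
    rw [contDiffOn_succ_iff_fderivWithin hS']
    refine ⟨fun y hy => (h2 y hy).differentiableWithinAt, by simp, ?_⟩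
    exact (ih h1).congr fun y hy => (h2 y hy).fderivWithin (hS' y hy)

/-- Integrals over compact sets depend smoothly on parameters. -/
theorem contMDiff_setIntegral [IsManifold I ∞ Q] [IsManifold J ∞ K] (hK : IsCompact K₀)
    {W : Type*} [NormedAddCommGroup W] [NormedSpace ℝ W] {f : Q → K → W}
    (hf : ContMDiff (I.prod J) 𝓘(ℝ, W) ∞ (Function.uncurry f)) :
    ContMDiff I 𝓘(ℝ, W) ∞ (fun q => ∫ k in K₀, f q k ∂μ) := by
  intro q
  rw [contMDiffAt_iff_source, contMDiffWithinAt_iff_contDiffWithinAt]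
  set φ := extChartAt I q
  obtain ⟨δ, hδ, hb⟩ := Metric.mem_nhdsWithin_iff.1 (extChartAt_target_mem_nhdsWithin (I := I) q)
  set S := Metric.ball (φ q) δ ∩ Set.range I with hSdef
  have hSc : Convex ℝ S := (convex_ball _ _).inter I.convex_range
  have hSu : UniqueDiffOn ℝ S := by
    rw [hSdef, Set.inter_comm]
    exact I.uniqueDiffOn.inter Metric.isOpen_ball
  have hsm : ContMDiffOn (𝓘(ℝ, E).prod J) 𝓘(ℝ, W) ∞
      (Function.uncurry fun y k => f (φ.symm y) k) (S ×ˢ Set.univ) := by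
    refine hf.comp_contMDiffOn (f := fun p : E × K => (φ.symm p.1, p.2)) ?_
    exact ((contMDiffOn_extChartAt_symm q).comp contMDiffOn_fst (fun p hp => hb hp.1)).prodMk
      contMDiffOn_snd
  have h : ContDiffOn ℝ ∞ (fun y => ∫ k in K₀, f (φ.symm y) k ∂μ) S :=
    contDiffOn_infty.2 fun m => contDiffOn_setIntegral hK hSc hSu m hsm
  have hq : φ q ∈ S := ⟨Metric.mem_ball_self hδ, by
    exact extChartAt_target_subset_range q (mem_extChartAt_target q)⟩
  exact (h _ hq).mono_of_mem_nhdsWithin (by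
    rw [hSdef, Set.inter_comm]
    exact inter_mem_nhdsWithin _ (Metric.ball_mem_nhds _ hδ))

end ParametricIntegral

/-! ### Local functions: evaluation on families and closure properties. -/

section LocalOps

variable {n : ℕ} [NeZero n] {M : Type*} [TopologicalSpace M]
  [ChartedSpace (EuclideanHalfSpace n) M] [IsManifold (𝓡∂ n) ∞ M] {ι : Type*} [Fintype ι]
  {W : Type*} [NormedAddCommGroup W] [NormedSpace ℝ W]
  {W' : Type*} [NormedAddCommGroup W'] [NormedSpace ℝ W']
  {F : Type*} [NormedAddCommGroup F] [NormedSpace ℝ F] {K : Type*} [TopologicalSpace K]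
  {J : ModelWithCorners ℝ F K} {N : Type*} [TopologicalSpace N] [ChartedSpace K N]

/-! ### Smooth families of configurations -/

theorem SmoothConfig.add {z v : Config M ι} (hz : SmoothConfig n z) (hv : SmoothConfig n v) :
    SmoothConfig n (z + v) := ContMDiff.add hz hv

theorem SmoothConfig.sub {z v : Config M ι} (hz : SmoothConfig n z) (hv : SmoothConfig n v) :
    SmoothConfig n (z - v) := ContMDiff.sub hz hv

theorem SmoothConfig.const_smul {v : Config M ι} (s : ℝ) (hv : SmoothConfig n v) :
    SmoothConfig n (s • v) :=
  (contMDiff_const (c := s) : ContMDiff (𝓡∂ n) 𝓘(ℝ, ℝ) ∞ fun _ : M => s).smul hv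

theorem lieD_add {z v : Config M ι} (hz : SmoothConfig n z) (hv : SmoothConfig n v)
    (X : VecField n M) : lieD X (z + v) = lieD X z + lieD X v := by
  funext x
  have := mfderiv_add ((hz x).mdifferentiableAt (by simp)) ((hv x).mdifferentiableAt (by simp))
  exact congrArg (fun l : EuclideanSpace ℝ (Fin n) →L[ℝ] (ι → ℝ) => l (X x)) this

theorem lieD_smul {v : Config M ι} (hv : SmoothConfig n v) (s : ℝ)
    (X : VecField n M) : lieD X (s • v) = s • lieD X v := by
  funext x
  have := const_smul_mfderiv ((hv x).mdifferentiableAt (by simp)) s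
  exact congrArg (fun l : EuclideanSpace ℝ (Fin n) →L[ℝ] (ι → ℝ) => l (X x)) this

/-- Iterated derivatives of a smooth family of configurations form a smooth family. -/
theorem contMDiff_iterD_family [IsManifold J ∞ N] {c : N → Config M ι}
    (hc : ContMDiff (J.prod (𝓡∂ n)) 𝓘(ℝ, ι → ℝ) ∞ (fun q : N × M => c q.1 q.2))
    (D : List (VecField n M)) :
    ContMDiff (J.prod (𝓡∂ n)) 𝓘(ℝ, ι → ℝ) ∞ (fun q : N × M => iterD D (c q.1) q.2) := by
  induction D with
  | nil => exact hc
  | cons X D ih =>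
    exact contMDiff_dirDeriv_param (N := N × M) (g := fun q x => iterD D (c q.1) x) (r := Prod.snd)
      (ih.comp ((contMDiff_fst.comp contMDiff_fst).prodMk contMDiff_snd)) contMDiff_snd X

theorem SmoothConfig.iterD {z : Config M ι} (hz : SmoothConfig n z) (D : List (VecField n M)) :
    SmoothConfig n (iterD D z) :=
  (contMDiff_iterD_family (N := ℝ) (J := 𝓘(ℝ, ℝ)) (c := fun _ => z)
    (ContMDiff.comp hz contMDiff_snd) D).comp
    (contMDiff_const (c := (0 : ℝ)).prodMk contMDiff_id)

theorem iterD_add {z v : Config M ι} (hz : SmoothConfig n z) (hv : SmoothConfig n v)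
    (D : List (VecField n M)) : iterD D (z + v) = iterD D z + iterD D v := by
  induction D with
  | nil => rfl
  | cons X D ih => simp only [BoundaryPoisson.iterD, ih, lieD_add (hz.iterD D) (hv.iterD D)]

theorem iterD_smul {v : Config M ι} (hv : SmoothConfig n v) (s : ℝ)
    (D : List (VecField n M)) : iterD D (s • v) = s • iterD D v := by
  induction D with
  | nil => rfl
  | cons X D ih => simp only [BoundaryPoisson.iterD, ih, lieD_smul (hv.iterD D)]

theorem iterD_eventually_zero {v : Config M ι} {x : M} (hv : ∀ᶠ y in 𝓝 x, v y = 0)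
    (D : List (VecField n M)) : ∀ᶠ y in 𝓝 x, iterD D v y = 0 := by
  induction D with
  | nil => exact hv
  | cons X D ih =>
    filter_upwards [ih.eventually_nhds] with y hy
    have h : iterD D v =ᶠ[𝓝 y] fun _ => (0 : ι → ℝ) := hy
    have := h.mfderiv_eq (I := 𝓡∂ n) (I' := 𝓘(ℝ, ι → ℝ))
    change mfderiv (𝓡∂ n) 𝓘(ℝ, ι → ℝ) (iterD D v) y (X y) = 0
    rw [this, mfderiv_const]
    rfl

/-! ### Operations on local functions -/

theorem IsLocalOp.of_fintype {A : Type*} [Fintype A] {f : ℝ → Config M ι → M → W}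
    (D : A → List (VecField n M)) (L : ℝ × (M × (A → ι → ℝ)) → W)
    (hL : ContMDiff (𝓘(ℝ, ℝ).prod ((𝓡∂ n).prod 𝓘(ℝ, A → ι → ℝ))) 𝓘(ℝ, W) ∞ L)
    (hf : ∀ (t : ℝ) (z : Config M ι), SmoothConfig n z →
      ∀ x, f t z x = L (t, x, fun j => iterD (D j) z x)) : IsLocalOp n f := by
  set e := Fintype.equivFin A
  refine ⟨Fintype.card A, fun j => D (e.symm j), fun q => L (q.1, q.2.1, fun j => q.2.2 (e j)),
    hL.comp ?_, fun t z hz x => by simp [hf t z hz x]⟩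
  refine contMDiff_fst.prodMk ((contMDiff_fst.comp contMDiff_snd).prodMk ?_)
  have : ContDiff ℝ ∞ (fun (a : Fin (Fintype.card A) → ι → ℝ) (j : A) => a (e j)) :=
    contDiff_pi.2 fun j => contDiff_apply ℝ (ι → ℝ) (e j)
  exact this.contMDiff.comp (contMDiff_snd.comp contMDiff_snd)

theorem isLocalOp_iterD (D : List (VecField n M)) :
    IsLocalOp n (fun (_ : ℝ) (z : Config M ι) x => iterD D z x) :=
  IsLocalOp.of_fintype (A := Unit) (fun _ => D) (fun q => q.2.2 ())
    ((contDiff_apply ℝ (ι → ℝ) ()).contMDiff.comp (contMDiff_snd.comp contMDiff_snd))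
    (fun _ _ _ _ => rfl)

theorem IsLocalOp.comp {f : ℝ → Config M ι → M → W} (hf : IsLocalOp n f)
    {Φ : ℝ × (M × W) → W'}
    (hΦ : ContMDiff (𝓘(ℝ, ℝ).prod ((𝓡∂ n).prod 𝓘(ℝ, W))) 𝓘(ℝ, W') ∞ Φ) :
    IsLocalOp n (fun t z x => Φ (t, x, f t z x)) := by
  obtain ⟨N, D, L, hL, h⟩ := hf
  refine ⟨N, D, fun q => Φ (q.1, q.2.1, L q), hΦ.comp ?_,
    fun t z hz x => congrArg (fun w => Φ (t, x, w)) (h t z hz x)⟩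
  exact contMDiff_fst.prodMk ((contMDiff_fst.comp contMDiff_snd).prodMk hL)

theorem IsLocalOp.comp_contDiff {f : ℝ → Config M ι → M → W} (hf : IsLocalOp n f)
    {Φ : W → W'} (hΦ : ContDiff ℝ ∞ Φ) : IsLocalOp n (fun t z x => Φ (f t z x)) :=
  hf.comp (Φ := fun q => Φ q.2.2) (hΦ.contMDiff.comp (contMDiff_snd.comp contMDiff_snd))

theorem IsLocalOp.congr {f g : ℝ → Config M ι → M → W} (hf : IsLocalOp n f)
    (h : ∀ t z, SmoothConfig n z → ∀ x, g t z x = f t z x) : IsLocalOp n g := by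
  obtain ⟨N, D, L, hL, hf⟩ := hf
  exact ⟨N, D, L, hL, fun t z hz x => (h t z hz x).trans (hf t z hz x)⟩

theorem isLocalOp_const (w : W) : IsLocalOp n (fun (_ : ℝ) (_ : Config M ι) (_ : M) => w) :=
  ⟨0, fun _ => [], fun _ => w, contMDiff_const, fun _ _ _ _ => rfl⟩

theorem isLocalOp_pi {A : Type*} [Fintype A] {f : A → ℝ → Config M ι → M → W}
    (hf : ∀ a, IsLocalOp n (f a)) : IsLocalOp n (fun t z x a => f a t z x) := by
  choose N D L hL h using hf
  refine IsLocalOp.of_fintype (A := Σ a, Fin (N a)) (fun p => D p.1 p.2)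
    (fun q a => L a (q.1, q.2.1, fun j => q.2.2 ⟨a, j⟩)) ?_
    (fun t z hz x => funext fun a => h a t z hz x)
  refine contMDiff_pi_space.2 fun a => (hL a).comp ?_
  refine contMDiff_fst.prodMk ((contMDiff_fst.comp contMDiff_snd).prodMk ?_)
  have : ContDiff ℝ ∞ (fun (b : (Σ a, Fin (N a)) → ι → ℝ) (j : Fin (N a)) => b ⟨a, j⟩) :=
    contDiff_pi.2 fun j => contDiff_apply ℝ (ι → ℝ) _
  exact this.contMDiff.comp (contMDiff_snd.comp contMDiff_snd)

theorem IsLocalOp.prodMk {f : ℝ → Config M ι → M → W} {g : ℝ → Config M ι → M → W'}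
    (hf : IsLocalOp n f) (hg : IsLocalOp n g) : IsLocalOp n (fun t z x => (f t z x, g t z x)) := by
  obtain ⟨N, D, L, hL, hf⟩ := hf
  obtain ⟨N', D', L', hL', hg⟩ := hg
  refine IsLocalOp.of_fintype (A := Fin N ⊕ Fin N') (Sum.elim D D')
    (fun q => (L (q.1, q.2.1, fun j => q.2.2 (Sum.inl j)),
      L' (q.1, q.2.1, fun j => q.2.2 (Sum.inr j)))) ?_
    (fun t z hz x => by rw [hf t z hz x, hg t z hz x]; rfl)
  refine ContMDiff.prodMk_space (hL.comp ?_) (hL'.comp ?_)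
  · refine contMDiff_fst.prodMk ((contMDiff_fst.comp contMDiff_snd).prodMk ?_)
    have : ContDiff ℝ ∞ (fun (b : Fin N ⊕ Fin N' → ι → ℝ) (j : Fin N) => b (Sum.inl j)) :=
      contDiff_pi.2 fun j => contDiff_apply ℝ (ι → ℝ) _
    exact this.contMDiff.comp (contMDiff_snd.comp contMDiff_snd)
  · refine contMDiff_fst.prodMk ((contMDiff_fst.comp contMDiff_snd).prodMk ?_)
    have : ContDiff ℝ ∞ (fun (b : Fin N ⊕ Fin N' → ι → ℝ) (j : Fin N') => b (Sum.inr j)) :=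
      contDiff_pi.2 fun j => contDiff_apply ℝ (ι → ℝ) _
    exact this.contMDiff.comp (contMDiff_snd.comp contMDiff_snd)

theorem IsLocalOp.add {f g : ℝ → Config M ι → M → W} (hf : IsLocalOp n f) (hg : IsLocalOp n g) :
    IsLocalOp n (fun t z x => f t z x + g t z x) :=
  (hf.prodMk hg).comp_contDiff contDiff_add

theorem IsLocalOp.const_smul {f : ℝ → Config M ι → M → W} (hf : IsLocalOp n f) (a : ℝ) :
    IsLocalOp n (fun t z x => a • f t z x) :=
  hf.comp_contDiff (contDiff_const_smul a)

theorem IsLocalOp.sub {f g : ℝ → Config M ι → M → W} (hf : IsLocalOp n f) (hg : IsLocalOp n g) :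
    IsLocalOp n (fun t z x => f t z x - g t z x) :=
  (hf.prodMk hg).comp_contDiff (contDiff_fst.sub contDiff_snd)

theorem contDiff_dotProduct : ContDiff ℝ ∞ (fun p : (ι → ℝ) × (ι → ℝ) => p.1 ⬝ᵥ p.2) := by
  simp only [dotProduct]
  fun_prop

theorem contDiff_mulVec (σ : Matrix ι ι ℝ) : ContDiff ℝ ∞ (fun p : ι → ℝ => σ *ᵥ p) :=
  (Matrix.mulVecLin σ).toContinuousLinearMap.contDiff

theorem IsLocalOp.dotProduct {f g : ℝ → Config M ι → M → ι → ℝ} (hf : IsLocalOp n f)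
    (hg : IsLocalOp n g) : IsLocalOp n (fun t z x => f t z x ⬝ᵥ g t z x) :=
  (hf.prodMk hg).comp_contDiff contDiff_dotProduct

/-- Evaluation of a local function on a smooth family of configurations. -/
theorem IsLocalOp.contMDiff_family [IsManifold J ∞ N] {f : ℝ → Config M ι → M → W}
    (hf : IsLocalOp n f) {t : N → ℝ} (ht : ContMDiff J 𝓘(ℝ, ℝ) ∞ t) {c : N → Config M ι}
    (hc : ContMDiff (J.prod (𝓡∂ n)) 𝓘(ℝ, ι → ℝ) ∞ (fun q : N × M => c q.1 q.2)) :
    ContMDiff (J.prod (𝓡∂ n)) 𝓘(ℝ, W) ∞ (fun q : N × M => f (t q.1) (c q.1) q.2) := by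
  obtain ⟨m, D, L, hL, h⟩ := hf
  have e : (fun q : N × M => f (t q.1) (c q.1) q.2) =
      fun q : N × M => L (t q.1, q.2, fun j => BoundaryPoisson.iterD (D j) (c q.1) q.2) := by
    funext q
    exact h _ _ (ContMDiff.comp hc (contMDiff_const.prodMk contMDiff_id)) _
  rw [e]
  refine hL.comp ((ht.comp contMDiff_fst).prodMk (contMDiff_snd.prodMk ?_))
  exact contMDiff_pi_space.2 fun j => contMDiff_iterD_family hc (D j)

theorem IsLocalOp.contMDiff {f : ℝ → Config M ι → M → W} (hf : IsLocalOp n f) (t : ℝ)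
    {z : Config M ι} (hz : SmoothConfig n z) : ContMDiff (𝓡∂ n) 𝓘(ℝ, W) ∞ (f t z) :=
  (hf.contMDiff_family (N := ℝ) (J := 𝓘(ℝ, ℝ)) (t := fun _ => t) contMDiff_const
    (c := fun _ => z) (ContMDiff.comp hz contMDiff_snd)).comp
    (contMDiff_const (c := (0 : ℝ)).prodMk contMDiff_id)

theorem IsLocalOp.smoothConfig {f : ℝ → Config M ι → Config M ι} (hf : IsLocalOp n f) (t : ℝ)
    {z : Config M ι} (hz : SmoothConfig n z) : SmoothConfig n (f t z) :=
  hf.contMDiff t hz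

/-- The derivative of a local function along a vector field is local. -/
theorem IsLocalOp.dirDeriv {f : ℝ → Config M ι → M → W} (hf : IsLocalOp n f) (X : VecField n M) :
    IsLocalOp n (fun t z x => BoundaryPoisson.dirDeriv (𝓡∂ n) (f t z) x (X x)) := by
  obtain ⟨m, D, L, hL, h⟩ := hf
  -- The second group of jet variables stands for the derivatives `X :: D j`; `L'` is the chain rule
  -- written in these variables.
  set L' : ℝ × (M × ((Fin m → ι → ℝ) × (Fin m → ι → ℝ))) → W := fun q =>
    BoundaryPoisson.dirDeriv (𝓡∂ n) (fun x' => L (q.1, x', q.2.2.1)) q.2.1 (X q.2.1) +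
      fderiv ℝ (fun a => L (q.1, q.2.1, a)) q.2.2.1 q.2.2.2
  have hL' : ContMDiff (𝓘(ℝ, ℝ).prod ((𝓡∂ n).prod
      𝓘(ℝ, (Fin m → ι → ℝ) × (Fin m → ι → ℝ)))) 𝓘(ℝ, W) ∞ L' := by
    have h22 : ContMDiff (𝓘(ℝ, ℝ).prod ((𝓡∂ n).prod 𝓘(ℝ, (Fin m → ι → ℝ) × (Fin m → ι → ℝ))))
        𝓘(ℝ, (Fin m → ι → ℝ) × (Fin m → ι → ℝ)) ∞
        (fun q : ℝ × (M × ((Fin m → ι → ℝ) × (Fin m → ι → ℝ))) => q.2.2) :=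
      contMDiff_snd.comp contMDiff_snd
    refine ContMDiff.add ?_ ?_
    · refine contMDiff_dirDeriv_param (M := M)
        (g := fun (q : ℝ × (M × ((Fin m → ι → ℝ) × (Fin m → ι → ℝ)))) x' => L (q.1, x', q.2.2.1))
        (r := fun q => q.2.1) ?_ (contMDiff_fst.comp contMDiff_snd) X
      exact hL.comp ((contMDiff_fst.comp contMDiff_fst).prodMk (contMDiff_snd.prodMk
        (contDiff_fst.contMDiff.comp (h22.comp contMDiff_fst))))
    · refine ContMDiff.clm_apply (contMDiff_fderiv_param
        (g := fun (q : ℝ × (M × ((Fin m → ι → ℝ) × (Fin m → ι → ℝ)))) a => L (q.1, q.2.1, a))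
        (r := fun q => q.2.2.1) ?_ (contDiff_fst.contMDiff.comp h22))
        (contDiff_snd.contMDiff.comp h22)
      exact hL.comp ((contMDiff_fst.comp contMDiff_fst).prodMk
        ((contMDiff_fst.comp (contMDiff_snd.comp contMDiff_fst)).prodMk contMDiff_snd))
  have hjet := (isLocalOp_pi (fun j => isLocalOp_iterD (n := n) (ι := ι) (D j))).prodMk
    (isLocalOp_pi (fun j => isLocalOp_iterD (n := n) (ι := ι) (X :: D j)))
  refine (hjet.comp hL').congr fun t z hz x => ?_
  have hLt : ContMDiff ((𝓡∂ n).prod 𝓘(ℝ, Fin m → ι → ℝ)) 𝓘(ℝ, W) ∞ (fun p => L (t, p)) :=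
    hL.comp (contMDiff_const.prodMk contMDiff_id)
  have hJ : ContMDiff (𝓡∂ n) 𝓘(ℝ, Fin m → ι → ℝ) ∞
      (fun x j => BoundaryPoisson.iterD (D j) z x) :=
    contMDiff_pi_space.2 fun j => hz.iterD (D j)
  have e1 : f t z = fun x => L (t, x, fun j => BoundaryPoisson.iterD (D j) z x) :=
    funext fun x => h t z hz x
  have e2 := dirDeriv_graph hLt hJ x (X x)
  have e3 : BoundaryPoisson.dirDeriv (𝓡∂ n) (fun x j => BoundaryPoisson.iterD (D j) z x) x (X x) =
      fun j => BoundaryPoisson.iterD (X :: D j) z x :=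
    funext fun j => dirDeriv_pi hJ x (X x) j
  rw [e3] at e2
  rw [e1]
  exact e2

theorem IsLocalOp.iterD {f : ℝ → Config M ι → Config M ι} (hf : IsLocalOp n f)
    (D : List (VecField n M)) : IsLocalOp n (fun t z x => iterD D (f t z) x) := by
  induction D with
  | nil => exact hf
  | cons X D ih => exact ih.dirDeriv X

/-- The variation of a local function. -/
theorem IsLocalOp.exists_variation {f : ℝ → Config M ι → M → W} (hf : IsLocalOp n f) :
    ∃ (m : ℕ) (D : Fin m → List (VecField n M))
      (L : ℝ × (M × ((Fin m → ι → ℝ) × (Fin m → ι → ℝ))) → W),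
      ContMDiff (𝓘(ℝ, ℝ).prod ((𝓡∂ n).prod 𝓘(ℝ, (Fin m → ι → ℝ) × (Fin m → ι → ℝ)))) 𝓘(ℝ, W) ∞ L ∧
      (∀ t x a, L (t, x, a, 0) = 0) ∧
      ∀ t (z v : Config M ι), SmoothConfig n z → SmoothConfig n v → ∀ x,
        HasDerivAt (fun s : ℝ => f t (z + s • v) x)
          (L (t, x, fun j => BoundaryPoisson.iterD (D j) z x,
            fun j => BoundaryPoisson.iterD (D j) v x)) 0 := by
  obtain ⟨m, D, L, hL, h⟩ := hf
  -- Iterated derivatives are linear, so z + s v moves the jet along a straight line and the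
  -- variation is the jet derivative of `L` applied to the jet of v.
  refine ⟨m, D, fun q => fderiv ℝ (fun a => L (q.1, q.2.1, a)) q.2.2.1 q.2.2.2, ?_,
    fun t x a => by simp, fun t z v hz hv x => ?_⟩
  · have h22 : ContMDiff (𝓘(ℝ, ℝ).prod ((𝓡∂ n).prod 𝓘(ℝ, (Fin m → ι → ℝ) × (Fin m → ι → ℝ))))
        𝓘(ℝ, (Fin m → ι → ℝ) × (Fin m → ι → ℝ)) ∞
        (fun q : ℝ × (M × ((Fin m → ι → ℝ) × (Fin m → ι → ℝ))) => q.2.2) :=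
      contMDiff_snd.comp contMDiff_snd
    refine ContMDiff.clm_apply (contMDiff_fderiv_param
      (g := fun (q : ℝ × (M × ((Fin m → ι → ℝ) × (Fin m → ι → ℝ)))) a => L (q.1, q.2.1, a))
      (r := fun q => q.2.2.1) ?_ (contDiff_fst.contMDiff.comp h22))
      (contDiff_snd.contMDiff.comp h22)
    exact hL.comp ((contMDiff_fst.comp contMDiff_fst).prodMk
      ((contMDiff_fst.comp (contMDiff_snd.comp contMDiff_fst)).prodMk contMDiff_snd))
  · have hLt : ContDiff ℝ ∞ (fun a => L (t, x, a)) := by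
      rw [← contMDiff_iff_contDiff]
      exact hL.comp (contMDiff_const.prodMk (contMDiff_const.prodMk contMDiff_id))
    have e : (fun s : ℝ => f t (z + s • v) x) = fun s => L (t, x,
        (fun j => BoundaryPoisson.iterD (D j) z x) +
          s • fun j => BoundaryPoisson.iterD (D j) v x) := by
      funext s
      rw [h t _ (hz.add (hv.const_smul s)) x]
      congr 3
      funext j
      rw [iterD_add hz (hv.const_smul s), iterD_smul hv]
      rfl
    rw [e]
    have h1 : HasDerivAt (fun s : ℝ => (fun j => BoundaryPoisson.iterD (D j) z x) +
          s • fun j => BoundaryPoisson.iterD (D j) v x)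
          (fun j => BoundaryPoisson.iterD (D j) v x) 0 := by
      simpa using ((hasDerivAt_id (0 : ℝ)).smul_const
        (fun j => BoundaryPoisson.iterD (D j) v x)).const_add
        (fun j => BoundaryPoisson.iterD (D j) z x)
    have h2 := (hLt.differentiable (by simp)
      ((fun j => BoundaryPoisson.iterD (D j) z x) +
          (0 : ℝ) • fun j => BoundaryPoisson.iterD (D j) v x)).hasFDerivAt
    simpa [Function.comp_def] using h2.comp_hasDerivAt (0 : ℝ) h1

/-- The variation of a local function under a local transformation is local. -/
theorem IsLocalOp.deriv {f : ℝ → Config M ι → M → W} (hf : IsLocalOp n f)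
    {U : ℝ → Config M ι → Config M ι} (hU : IsLocalOp n U) :
    IsLocalOp n (fun t z x => deriv (fun s : ℝ => f t (z + s • U t z) x) 0) := by
  obtain ⟨m, D, L, hL, -, h⟩ := hf.exists_variation
  have hjet := (isLocalOp_pi (fun j => isLocalOp_iterD (n := n) (ι := ι) (D j))).prodMk
    (isLocalOp_pi (fun j => hU.iterD (D j)))
  exact (hjet.comp hL).congr fun t z hz x => (h t z _ hz (hU.smoothConfig t hz) x).deriv

/-- The linearization at x depends linearly on the jet of v at x, so it cannot enlarge supports.
This keeps brackets with compactly supported test variations admissible. -/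
theorem IsLocalOp.deriv_eventually_zero {f : ℝ → Config M ι → M → W} (hf : IsLocalOp n f) (t : ℝ)
    {z v : Config M ι} (hz : SmoothConfig n z) (hv : SmoothConfig n v) {x : M}
    (hx : ∀ᶠ y in 𝓝 x, v y = 0) :
    ∀ᶠ y in 𝓝 x, _root_.deriv (fun s : ℝ => f t (z + s • v) y) 0 = 0 := by
  obtain ⟨m, D, L, hL, h0, h⟩ := hf.exists_variation
  filter_upwards [Filter.eventually_all.2 fun j => iterD_eventually_zero hx (D j)] with y hy
  rw [(h t z v hz hv y).deriv, show (fun j => BoundaryPoisson.iterD (D j) v y) = 0 from funext hy,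
    h0]

end LocalOps

/-! ### Differentiation of functions of two real variables. -/

section TwoVariables

variable {P W : Type*} [NormedAddCommGroup P] [NormedSpace ℝ P] [NormedAddCommGroup W]
  [NormedSpace ℝ W]

theorem contDiff_deriv_param {h : P → ℝ → W} (hh : ContDiff ℝ ∞ (fun q : P × ℝ => h q.1 q.2))
    (r : ℝ) : ContDiff ℝ ∞ (fun p => deriv (h p) r) := by
  have : ContDiff ℝ ∞ (fun p => fderiv ℝ (h p) r) :=
    ContDiff.fderiv (n := ∞) (m := ∞) hh contDiff_const (by simp)
  simpa only [fderiv_apply_one_eq_deriv] using this.clm_apply (contDiff_const (c := (1 : ℝ)))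

/-- Separates two occurrences of one parameter; every product rule on the space of histories below
is derived from it. -/
theorem deriv_diag {h : ℝ → ℝ → W} (hh : ContDiff ℝ ∞ (fun q : ℝ × ℝ => h q.1 q.2)) :
    deriv (fun s => h s s) 0 = deriv (fun s => h s 0) 0 + deriv (fun r => h 0 r) 0 := by
  have hd := (hh.differentiable (by simp) ((0 : ℝ), (0 : ℝ))).hasFDerivAt
  have h1 : HasDerivAt (fun s : ℝ => (s, s)) ((1, 1) : ℝ × ℝ) 0 :=
    (hasDerivAt_id 0).prodMk (hasDerivAt_id 0)
  have h2 : HasDerivAt (fun s : ℝ => (s, (0 : ℝ))) ((1, 0) : ℝ × ℝ) 0 :=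
    (hasDerivAt_id 0).prodMk (hasDerivAt_const 0 0)
  have h3 : HasDerivAt (fun s : ℝ => ((0 : ℝ), s)) ((0, 1) : ℝ × ℝ) 0 :=
    (hasDerivAt_const 0 0).prodMk (hasDerivAt_id 0)
  have e1 := (HasFDerivAt.comp_hasDerivAt (f := fun s : ℝ => (s, s)) 0 hd h1).deriv
  have e2 := (HasFDerivAt.comp_hasDerivAt (f := fun s : ℝ => (s, (0 : ℝ))) 0 hd h2).deriv
  have e3 := (HasFDerivAt.comp_hasDerivAt (f := fun s : ℝ => ((0 : ℝ), s)) 0 hd h3).deriv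
  simp only [Function.comp_def] at e1 e2 e3
  rw [e1, e2, e3, ← map_add]
  simp

theorem deriv_deriv_comm {h : ℝ → ℝ → W} (hh : ContDiff ℝ ∞ (fun q : ℝ × ℝ => h q.1 q.2)) :
    deriv (fun s => deriv (fun r => h s r) 0) 0 = deriv (fun r => deriv (fun s => h s r) 0) 0 := by
  set u : ℝ × ℝ → W := fun q => h q.1 q.2
  have hd := fun q => (hh.differentiable (by simp) q).hasFDerivAt
  have h2 : ∀ r s : ℝ, HasDerivAt (fun s : ℝ => (s, r)) ((1, 0) : ℝ × ℝ) s := fun r s =>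
    (hasDerivAt_id s).prodMk (hasDerivAt_const s r)
  have h3 : ∀ r s : ℝ, HasDerivAt (fun r : ℝ => (s, r)) ((0, 1) : ℝ × ℝ) r := fun r s =>
    (hasDerivAt_const r s).prodMk (hasDerivAt_id r)
  have e1 : ∀ s, deriv (fun r => h s r) 0 = fderiv ℝ u (s, 0) (0, 1) := fun s =>
    (HasFDerivAt.comp_hasDerivAt (f := fun r : ℝ => (s, r)) 0 (hd (s, 0)) (h3 0 s)).deriv
  have e2 : ∀ r, deriv (fun s => h s r) 0 = fderiv ℝ u (0, r) (1, 0) := fun r =>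
    (HasFDerivAt.comp_hasDerivAt (f := fun s : ℝ => (s, r)) 0 (hd (0, r)) (h2 r 0)).deriv
  simp_rw [e1, e2]
  have hD : HasFDerivAt (fderiv ℝ u) (fderiv ℝ (fderiv ℝ u) (0, 0)) (0, 0) :=
    ((hh.fderiv_right (m := ∞) (by simp)).differentiable (by simp) _).hasFDerivAt
  have e3 := (HasFDerivAt.comp_hasDerivAt (f := fun s : ℝ => (s, (0 : ℝ))) 0
    ((ContinuousLinearMap.apply ℝ W ((0, 1) : ℝ × ℝ)).hasFDerivAt.comp _ hD) (h2 0 0)).deriv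
  have e4 := (HasFDerivAt.comp_hasDerivAt (f := fun r : ℝ => ((0 : ℝ), r)) 0
    ((ContinuousLinearMap.apply ℝ W ((1, 0) : ℝ × ℝ)).hasFDerivAt.comp _ hD) (h3 0 0)).deriv
  simp only [Function.comp_def, ContinuousLinearMap.apply_apply,
    ContinuousLinearMap.coe_comp] at e3 e4
  rw [e3, e4]
  have := hh.contDiffAt.isSymmSndFDerivAt (x := ((0 : ℝ), (0 : ℝ)))
    (by simpa using (ENat.LEInfty.out : (2 : WithTop ℕ∞) ≤ ∞))
  exact this (1, 0) (0, 1)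

end TwoVariables

/-! ### Differential calculus on the space of histories. -/

section Families

variable {n : ℕ} [NeZero n] {M : Type*} [TopologicalSpace M]
  [ChartedSpace (EuclideanHalfSpace n) M] {ι : Type*} [Fintype ι]
  {P : Type*} [NormedAddCommGroup P] [NormedSpace ℝ P]
  {P' : Type*} [NormedAddCommGroup P'] [NormedSpace ℝ P']
  {W : Type*} [NormedAddCommGroup W] [NormedSpace ℝ W]

theorem SmoothFamily.comp {c : P → History M ι} (hc : SmoothFamily n c) {g : P' → P}
    (hg : ContDiff ℝ ∞ g) : SmoothFamily n (fun s => c (g s)) :=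
  ContMDiff.comp (g := fun q : P × (ℝ × M) => c q.1 q.2.1 q.2.2)
    (f := fun q : P' × (ℝ × M) => (g q.1, q.2)) hc
    ((hg.contMDiff.comp contMDiff_fst).prodMk contMDiff_snd)

theorem SmoothFamily.add {c d : P → History M ι} (hc : SmoothFamily n c) (hd : SmoothFamily n d) :
    SmoothFamily n (fun s => c s + d s) := ContMDiff.add hc hd

theorem SmoothFamily.smul {d : P → History M ι} {f : P → ℝ} (hf : ContDiff ℝ ∞ f)
    (hd : SmoothFamily n d) : SmoothFamily n (fun s => f s • d s) :=
  ContMDiff.smul (f := fun q : P × (ℝ × M) => f q.1) (hf.contMDiff.comp contMDiff_fst) hd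

theorem SmoothHistory.family {z : History M ι} (hz : SmoothHistory n z) :
    SmoothFamily n (fun _ : P => z) :=
  ContMDiff.comp (g := fun q : ℝ × M => z q.1 q.2) hz contMDiff_snd

theorem SmoothFamily.smoothHistory {c : P → History M ι} (hc : SmoothFamily n c) (s : P) :
    SmoothHistory n (c s) :=
  ContMDiff.comp (g := fun q : P × (ℝ × M) => c q.1 q.2.1 q.2.2)
    (f := fun q : ℝ × M => (s, q)) hc (contMDiff_const.prodMk contMDiff_id)

theorem SmoothHistory.add {z v : History M ι} (hz : SmoothHistory n z) (hv : SmoothHistory n v) :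
    SmoothHistory n (z + v) := ContMDiff.add hz hv

theorem SmoothHistory.sub {z v : History M ι} (hz : SmoothHistory n z) (hv : SmoothHistory n v) :
    SmoothHistory n (z - v) := ContMDiff.sub hz hv

theorem SmoothHistory.const_smul {v : History M ι} (hv : SmoothHistory n v) (s : ℝ) :
    SmoothHistory n (s • v) :=
  (hv.family.smul (P := ℝ) (f := fun _ => s) contDiff_const).smoothHistory 0

theorem SmoothHistory.line {z v : History M ι} (hz : SmoothHistory n z) (hv : SmoothHistory n v) :
    SmoothFamily n (fun s : ℝ => z + s • v) :=
  hz.family.add (hv.family.smul contDiff_id)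

theorem SmoothHistory.config {z : History M ι} (hz : SmoothHistory n z) (t : ℝ) :
    SmoothConfig n (z t) :=
  ContMDiff.comp (g := fun q : ℝ × M => z q.1 q.2) (f := fun x => (t, x)) hz
    (contMDiff_const.prodMk contMDiff_id)

theorem SmoothConfig.history {z : Config M ι} (hz : SmoothConfig n z) :
    SmoothHistory n (fun _ => z) :=
  ContMDiff.comp (g := z) hz contMDiff_snd

/-! ### Smooth functions on the space of histories -/

variable (n) in
/-- A function of the histories is smooth if it is smooth on smooth finite dimensional families. -/
def SmoothFun (Φ : History M ι → W) : Prop :=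
  ∀ (p : ℕ) (c : (Fin p → ℝ) → History M ι), SmoothFamily n c → ContDiff ℝ ∞ (fun s => Φ (c s))

variable (n) in
/-- A function of the histories and of `t`, `x` is smooth if it sends smooth finite dimensional
families of histories to functions which are smooth in all variables. -/
def SmoothObs (A : History M ι → ℝ → M → W) : Prop :=
  ∀ (p : ℕ) (c : (Fin p → ℝ) → History M ι), SmoothFamily n c →
    ContMDiff (𝓘(ℝ, Fin p → ℝ).prod (𝓘(ℝ, ℝ).prod (𝓡∂ n))) 𝓘(ℝ, W) ∞
      (fun q : (Fin p → ℝ) × (ℝ × M) => A (c q.1) q.2.1 q.2.2)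

/-- The derivative of a function of the histories at `z`, in the direction `v`. -/
def varDir (Φ : History M ι → W) (z v : History M ι) : W :=
  deriv (fun s : ℝ => Φ (z + s • v)) 0

/-- The derivative of a function of the histories along a vector field. -/
def lie (U : History M ι → History M ι) (Φ : History M ι → W) : History M ι → W :=
  fun z => varDir Φ z (U z)

/-- A vector field is an observable valued in `ι → ℝ`, so closure properties of observables transfer
to vector fields. -/
theorem smoothVariation_iff {U : History M ι → History M ι} :
    SmoothVariation n U ↔ SmoothObs n (fun z t x => U z t x) := Iff.rfl

/-- The definition tests only parameter spaces `Fin p → ℝ`; a basis of `P` carries it to products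
such as `(Fin p → ℝ) × ℝ`, needed when an extra deformation parameter is added. -/
theorem SmoothObs.family [FiniteDimensional ℝ P] {A : History M ι → ℝ → M → W}
    (hA : SmoothObs n A) {c : P → History M ι} (hc : SmoothFamily n c) :
    ContMDiff (𝓘(ℝ, P).prod (𝓘(ℝ, ℝ).prod (𝓡∂ n))) 𝓘(ℝ, W) ∞
      (fun q : P × (ℝ × M) => A (c q.1) q.2.1 q.2.2) := by
  set e := (Module.finBasis ℝ P).equivFunL
  have h := (hA _ _ (hc.comp e.symm.contDiff)).comp
    (f := fun q : P × (ℝ × M) => (e q.1, q.2))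
    ((e.contDiff.contMDiff.comp contMDiff_fst).prodMk contMDiff_snd)
  refine h.congr fun q => ?_
  simp

theorem SmoothFun.family [FiniteDimensional ℝ P] {Φ : History M ι → W}
    (hΦ : SmoothFun n Φ) {c : P → History M ι} (hc : SmoothFamily n c) :
    ContDiff ℝ ∞ (fun s => Φ (c s)) := by
  set e := (Module.finBasis ℝ P).equivFunL
  have h := (hΦ _ _ (hc.comp e.symm.contDiff)).comp e.contDiff
  simpa [Function.comp_def] using h

theorem SmoothVariation.family [FiniteDimensional ℝ P] {U : History M ι → History M ι}
    (hU : SmoothVariation n U) {c : P → History M ι} (hc : SmoothFamily n c) :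
    SmoothFamily n (fun s => U (c s)) :=
  SmoothObs.family (smoothVariation_iff.1 hU) hc

theorem SmoothVariation.smoothHistory {U : History M ι → History M ι}
    (hU : SmoothVariation n U) {z : History M ι} (hz : SmoothHistory n z) :
    SmoothHistory n (U z) :=
  (hU.family (P := ℝ) hz.family).smoothHistory 0

theorem SmoothObs.smoothFun {A : History M ι → ℝ → M → W} (hA : SmoothObs n A) (t : ℝ) (x : M) :
    SmoothFun n (fun z => A z t x) := fun p c hc => by
  rw [← contMDiff_iff_contDiff]
  exact (hA p c hc).comp (contMDiff_id.prodMk (contMDiff_const (c := (t, x))))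

theorem SmoothFun.contDiff_line {Φ : History M ι → W} (hΦ : SmoothFun n Φ) {z v : History M ι}
    (hz : SmoothHistory n z) (hv : SmoothHistory n v) :
    ContDiff ℝ ∞ (fun s : ℝ => Φ (z + s • v)) :=
  hΦ.family (hz.line hv)

theorem SmoothFun.hasDerivAt {Φ : History M ι → W} (hΦ : SmoothFun n Φ) {z v : History M ι}
    (hz : SmoothHistory n z) (hv : SmoothHistory n v) :
    HasDerivAt (fun s : ℝ => Φ (z + s • v)) (varDir Φ z v) 0 :=
  ((hΦ.contDiff_line hz hv).differentiable (by simp) 0).hasDerivAt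

theorem varDir_congr {Φ Ψ : History M ι → W} (h : ∀ z, SmoothHistory n z → Φ z = Ψ z)
    {z v : History M ι} (hz : SmoothHistory n z) (hv : SmoothHistory n v) :
    varDir Φ z v = varDir Ψ z v := by
  unfold varDir
  congr 1
  funext s
  exact h _ (hz.add (hv.const_smul s))

theorem SmoothFun.varDir_sub {Φ Ψ : History M ι → W} (hΦ : SmoothFun n Φ) (hΨ : SmoothFun n Ψ)
    {z v : History M ι} (hz : SmoothHistory n z) (hv : SmoothHistory n v) :
    varDir (fun z => Φ z - Ψ z) z v = varDir Φ z v - varDir Ψ z v :=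
  ((hΦ.hasDerivAt hz hv).sub (hΨ.hasDerivAt hz hv)).deriv

theorem SmoothFun.varDir_add {Φ Ψ : History M ι → W} (hΦ : SmoothFun n Φ) (hΨ : SmoothFun n Ψ)
    {z v : History M ι} (hz : SmoothHistory n z) (hv : SmoothHistory n v) :
    varDir (fun z => Φ z + Ψ z) z v = varDir Φ z v + varDir Ψ z v :=
  ((hΦ.hasDerivAt hz hv).add (hΨ.hasDerivAt hz hv)).deriv

theorem SmoothFun.sub {Φ Ψ : History M ι → W} (hΦ : SmoothFun n Φ) (hΨ : SmoothFun n Ψ) :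
    SmoothFun n (fun z => Φ z - Ψ z) := fun p c hc => (hΦ p c hc).sub (hΨ p c hc)

theorem SmoothFun.lie {Φ : History M ι → W} (hΦ : SmoothFun n Φ) {U : History M ι → History M ι}
    (hU : SmoothVariation n U) : SmoothFun n (lie U Φ) := fun p c hc => by
  refine contDiff_deriv_param (h := fun s (r : ℝ) => Φ (c s + r • U (c s))) ?_ 0
  exact hΦ.family (P := (Fin p → ℝ) × ℝ) (c := fun q => c q.1 + q.2 • U (c q.1))
    ((hc.comp contDiff_fst).add (((hU p c hc).comp contDiff_fst).smul contDiff_snd))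

variable [IsManifold (𝓡∂ n) ∞ M]

theorem SmoothObs.lie {A : History M ι → ℝ → M → W} (hA : SmoothObs n A)
    {U : History M ι → History M ι} (hU : SmoothVariation n U) :
    SmoothObs n (fun z t x => lie U (fun z => A z t x) z) := fun p c hc => by
  refine contMDiff_deriv_param (N := (Fin p → ℝ) × (ℝ × M))
    (J := 𝓘(ℝ, Fin p → ℝ).prod (𝓘(ℝ, ℝ).prod (𝓡∂ n)))
    (g := fun q (r : ℝ) => A (c q.1 + r • U (c q.1)) q.2.1 q.2.2) (r := fun _ => 0) ?_
    contMDiff_const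
  have h := hA.family (P := (Fin p → ℝ) × ℝ) (c := fun q => c q.1 + q.2 • U (c q.1))
    ((hc.comp contDiff_fst).add (((hU p c hc).comp contDiff_fst).smul contDiff_snd))
  refine h.comp (f := fun q : ((Fin p → ℝ) × (ℝ × M)) × ℝ => ((q.1.1, q.2), q.1.2)) ?_
  exact ((contMDiff_fst.comp contMDiff_fst).prodMk_space contMDiff_snd).prodMk
    (contMDiff_snd.comp contMDiff_fst)

theorem SmoothObs.totalTime {A : History M ι → ℝ → M → ℝ} (hA : SmoothObs n A) :
    SmoothObs n (totalTime A) := fun p c hc => by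
  refine contMDiff_deriv_param (N := (Fin p → ℝ) × (ℝ × M))
    (J := 𝓘(ℝ, Fin p → ℝ).prod (𝓘(ℝ, ℝ).prod (𝓡∂ n)))
    (g := fun q (r : ℝ) => A (c q.1) r q.2.2) (r := fun q => q.2.1) ?_
    (contMDiff_fst.comp contMDiff_snd)
  refine (hA p c hc).comp (f := fun q : ((Fin p → ℝ) × (ℝ × M)) × ℝ => (q.1.1, (q.2, q.1.2.2))) ?_
  exact (contMDiff_fst.comp contMDiff_fst).prodMk (contMDiff_snd.prodMk
    (contMDiff_snd.comp (contMDiff_snd.comp contMDiff_fst)))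

theorem SmoothObs.partialTime {A : History M ι → ℝ → M → ℝ} (hA : SmoothObs n A) :
    SmoothObs n (partialTime A) := fun p c hc => by
  refine contMDiff_deriv_param (N := (Fin p → ℝ) × (ℝ × M))
    (J := 𝓘(ℝ, Fin p → ℝ).prod (𝓘(ℝ, ℝ).prod (𝓡∂ n)))
    (g := fun q (s : ℝ) => A (fun r => c q.1 (r - s)) (q.2.1 + s) q.2.2) (r := fun _ => 0) ?_
    contMDiff_const
  -- The time shift becomes one more parameter of the family.
  have hc' : SmoothFamily n (fun (q : (Fin p → ℝ) × ℝ) (r : ℝ) => c q.1 (r - q.2)) := by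
    refine ContMDiff.comp (g := fun q : (Fin p → ℝ) × (ℝ × M) => c q.1 q.2.1 q.2.2)
      (f := fun q : ((Fin p → ℝ) × ℝ) × (ℝ × M) => (q.1.1, (q.2.1 - q.1.2, q.2.2))) hc ?_
    exact (contDiff_fst.contMDiff.comp contMDiff_fst).prodMk
      (((contMDiff_fst.comp contMDiff_snd).sub (contDiff_snd.contMDiff.comp contMDiff_fst)).prodMk
        (contMDiff_snd.comp contMDiff_snd))
  refine (hA.family hc').comp
    (f := fun q : ((Fin p → ℝ) × (ℝ × M)) × ℝ => ((q.1.1, q.2), (q.1.2.1 + q.2, q.1.2.2))) ?_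
  exact ((contMDiff_fst.comp contMDiff_fst).prodMk_space contMDiff_snd).prodMk
    (((contMDiff_fst.comp (contMDiff_snd.comp contMDiff_fst)).add contMDiff_snd).prodMk
      (contMDiff_snd.comp (contMDiff_snd.comp contMDiff_fst)))

theorem SmoothObs.add {A B : History M ι → ℝ → M → W} (hA : SmoothObs n A) (hB : SmoothObs n B) :
    SmoothObs n (fun z t x => A z t x + B z t x) := fun p c hc => (hA p c hc).add (hB p c hc)

theorem SmoothObs.sub {A B : History M ι → ℝ → M → W} (hA : SmoothObs n A) (hB : SmoothObs n B) :
    SmoothObs n (fun z t x => A z t x - B z t x) := fun p c hc => (hA p c hc).sub (hB p c hc)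

theorem IsLocalOp.smoothObs {f : ℝ → Config M ι → M → W} (hf : IsLocalOp n f) :
    SmoothObs n (fun z t x => f t (z t) x) := fun p c hc => by
  have h := hf.contMDiff_family (N := (Fin p → ℝ) × ℝ) (J := 𝓘(ℝ, Fin p → ℝ).prod 𝓘(ℝ, ℝ))
    (t := Prod.snd) contMDiff_snd (c := fun q => c q.1 q.2)
    (ContMDiff.comp (g := fun q : (Fin p → ℝ) × (ℝ × M) => c q.1 q.2.1 q.2.2) hc
      ((contMDiff_fst.comp contMDiff_fst).prodMk
        ((contMDiff_snd.comp contMDiff_fst).prodMk contMDiff_snd)))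
  exact h.comp (f := fun q : (Fin p → ℝ) × (ℝ × M) => ((q.1, q.2.1), q.2.2))
    ((contMDiff_fst.prodMk (contMDiff_fst.comp contMDiff_snd)).prodMk
      (contMDiff_snd.comp contMDiff_snd))

/-! ### The chain rule -/

/-- Hadamard's lemma for smooth curves of histories. -/
theorem SmoothFamily.exists_slope {c : ℝ → History M ι} (hc : SmoothFamily n c) :
    ∃ w : ℝ → History M ι, SmoothFamily n w ∧ (∀ s, c s = c 0 + s • w s) ∧
      ∀ t x, w 0 t x = deriv (fun s => c s t x) 0 := by
  have hderiv : ContMDiff ((𝓘(ℝ, ℝ).prod (𝓘(ℝ, ℝ).prod (𝓡∂ n))).prod 𝓘(ℝ, ℝ)) 𝓘(ℝ, ι → ℝ) ∞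
      (Function.uncurry fun (q : ℝ × (ℝ × M)) (θ : ℝ) =>
        deriv (fun r => c r q.2.1 q.2.2) (θ * q.1)) := by
    refine contMDiff_deriv_param (N := (ℝ × (ℝ × M)) × ℝ)
      (J := (𝓘(ℝ, ℝ).prod (𝓘(ℝ, ℝ).prod (𝓡∂ n))).prod 𝓘(ℝ, ℝ))
      (g := fun q r => c r q.1.2.1 q.1.2.2) (r := fun q => q.2 * q.1.1) ?_ ?_
    · exact ContMDiff.comp (g := fun q : ℝ × (ℝ × M) => c q.1 q.2.1 q.2.2)
        (f := fun q : ((ℝ × (ℝ × M)) × ℝ) × ℝ => (q.2, q.1.1.2)) hc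
        (contMDiff_snd.prodMk (contMDiff_snd.comp (contMDiff_fst.comp contMDiff_fst)))
    · exact contMDiff_snd.mul (contMDiff_fst.comp contMDiff_fst)
  have hcs : ∀ t x, ContDiff ℝ ∞ (fun s => c s t x) := fun t x => by
    rw [← contMDiff_iff_contDiff]
    exact ContMDiff.comp (g := fun q : ℝ × (ℝ × M) => c q.1 q.2.1 q.2.2) hc
      (contMDiff_id.prodMk (contMDiff_const (c := (t, x))))
  -- The slope is the average of the velocity between parameters 0 and s; it is jointly smooth by
  -- `contMDiff_setIntegral`.
  refine ⟨fun s t x => ∫ θ in Set.Icc (0 : ℝ) 1, deriv (fun r => c r t x) (θ * s),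
    contMDiff_setIntegral (μ := volume) (I := 𝓘(ℝ, ℝ).prod (𝓘(ℝ, ℝ).prod (𝓡∂ n)))
      (Q := ℝ × (ℝ × M)) isCompact_Icc hderiv, fun s => ?_, fun t x => by simp⟩
  funext t x
  have hcd : Continuous (deriv fun s => c s t x) := (hcs t x).continuous_deriv (by simp)
  have h1 : ∀ θ : ℝ, HasDerivAt (fun θ => c (θ * s) t x)
      (s • deriv (fun s => c s t x) (θ * s)) θ := fun θ =>
    HasDerivAt.scomp (h := fun θ : ℝ => θ * s) θ
      ((hcs t x).differentiable (by simp) (θ * s)).hasDerivAt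
      (by simpa using (hasDerivAt_id θ).mul_const s)
  have h2 := intervalIntegral.integral_eq_sub_of_hasDerivAt (a := (0 : ℝ)) (b := 1)
    (fun θ _ => h1 θ) (Continuous.intervalIntegrable (by fun_prop) _ _)
  rw [intervalIntegral.integral_smul, intervalIntegral.integral_of_le zero_le_one,
    ← integral_Icc_eq_integral_Ioc] at h2
  simp only [one_mul, zero_mul] at h2
  simp only [Pi.add_apply, Pi.smul_apply]
  rw [h2]
  abel

/-- The derivative of a smooth function along a curve depends on the velocity only. -/
theorem SmoothFun.deriv_curve {Φ : History M ι → W} (hΦ : SmoothFun n Φ) {c : ℝ → History M ι}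
    (hc : SmoothFamily n c) {w : History M ι} (hw : ∀ t x, deriv (fun s => c s t x) 0 = w t x) :
    deriv (fun s => Φ (c s)) 0 = varDir Φ (c 0) w := by
  obtain ⟨v, hv, hcv, hv0⟩ := hc.exists_slope
  have hvw : v 0 = w := by
    funext t x
    rw [hv0, hw]
  -- Decouple the factor s from the slope at s. At factor zero the slope is irrelevant, so only the
  -- derivative in the factor survives on the diagonal.
  have h : ContDiff ℝ ∞ (fun q : ℝ × ℝ => Φ (c 0 + q.1 • v q.2)) :=
    hΦ.family (((hc.smoothHistory 0).family).add ((hv.comp contDiff_snd).smul contDiff_fst))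
  have h1 := deriv_diag (h := fun s r => Φ (c 0 + s • v r)) h
  rw [show (fun s => Φ (c s)) = fun s => Φ (c 0 + s • v s) from
    funext fun s => congrArg Φ (hcv s), h1, hvw]
  simp [varDir]

/-- Additivity of directional derivatives is not automatic; it comes from smoothness on the
two-parameter family z + s v + r w. -/
theorem SmoothFun.varDir_add_right {Φ : History M ι → W} (hΦ : SmoothFun n Φ)
    {z v w : History M ι} (hz : SmoothHistory n z) (hv : SmoothHistory n v)
    (hw : SmoothHistory n w) : varDir Φ z (v + w) = varDir Φ z v + varDir Φ z w := by
  have h : ContDiff ℝ ∞ (fun q : ℝ × ℝ => Φ (z + q.1 • v + q.2 • w)) :=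
    hΦ.family ((hz.family.add (hv.family.smul contDiff_fst)).add (hw.family.smul contDiff_snd))
  have h1 := deriv_diag (h := fun s r => Φ (z + s • v + r • w)) h
  simpa [varDir, add_assoc] using h1

theorem SmoothFun.varDir_smul_right {Φ : History M ι → W} (hΦ : SmoothFun n Φ)
    {z v : History M ι} (hz : SmoothHistory n z) (hv : SmoothHistory n v) (a : ℝ) :
    varDir Φ z (a • v) = a • varDir Φ z v := by
  have h1 : HasDerivAt (fun s : ℝ => s * a) a 0 := by
    simpa using (hasDerivAt_id (0 : ℝ)).mul_const a
  have h2 : HasDerivAt (fun s : ℝ => Φ (z + s • v)) (varDir Φ z v) (0 * a) := by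
    simpa using hΦ.hasDerivAt hz hv
  have h3 := (h2.scomp (0 : ℝ) h1).deriv
  simpa [Function.comp_def, varDir, smul_smul] using h3

theorem SmoothFun.varDir_sub_right {Φ : History M ι → W} (hΦ : SmoothFun n Φ)
    {z v w : History M ι} (hz : SmoothHistory n z) (hv : SmoothHistory n v)
    (hw : SmoothHistory n w) : varDir Φ z (v - w) = varDir Φ z v - varDir Φ z w := by
  have := hΦ.varDir_add_right hz (hv.sub hw) hw
  rw [sub_add_cancel] at this
  rw [this, add_sub_cancel_right]

/-- The derivative of the vector field `V` along `U`. -/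
def lieVec (U V : History M ι → History M ι) : History M ι → History M ι :=
  fun z t x => lie U (fun z => V z t x) z

/-- The commutator of two vector fields on the space of histories. -/
def bracket (U V : History M ι → History M ι) : History M ι → History M ι :=
  fun z => lieVec U V z - lieVec V U z

theorem SmoothVariation.lieVec {U V : History M ι → History M ι} (hU : SmoothVariation n U)
    (hV : SmoothVariation n V) : SmoothVariation n (lieVec U V) :=
  SmoothObs.lie (smoothVariation_iff.1 hV) hU

theorem SmoothVariation.sub {U V : History M ι → History M ι} (hU : SmoothVariation n U)
    (hV : SmoothVariation n V) : SmoothVariation n (fun z => U z - V z) :=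
  SmoothObs.sub (smoothVariation_iff.1 hU) (smoothVariation_iff.1 hV)

theorem SmoothVariation.bracket {U V : History M ι → History M ι} (hU : SmoothVariation n U)
    (hV : SmoothVariation n V) : SmoothVariation n (bracket U V) :=
  (hU.lieVec hV).sub (hV.lieVec hU)

/-- The outer derivative acts on the base point and on the field V. Freezing V gives a mixed second
derivative, symmetric in U and V and hence absent from the commutator; the other part is the
derivative along U(V). -/
theorem SmoothFun.lie_lie {Φ : History M ι → W} (hΦ : SmoothFun n Φ)
    {U V : History M ι → History M ι} (hU : SmoothVariation n U) (hV : SmoothVariation n V)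
    {z : History M ι} (hz : SmoothHistory n z) :
    BoundaryPoisson.lie U (BoundaryPoisson.lie V Φ) z =
      deriv (fun s : ℝ => deriv (fun r : ℝ => Φ (z + s • U z + r • V z)) 0) 0 +
        varDir Φ z (BoundaryPoisson.lieVec U V z) := by
  have hu := hU.smoothHistory hz
  have hv := hV.smoothHistory hz
  set u := U z
  have hVq : SmoothFamily n (fun q : ℝ => V (z + q • u)) := hV.family (hz.line hu)
  have hG : ContDiff ℝ ∞ (fun q : ℝ × ℝ =>
      deriv (fun r : ℝ => Φ (z + q.1 • u + r • V (z + q.2 • u))) 0) := by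
    refine contDiff_deriv_param
      (h := fun (q : ℝ × ℝ) (r : ℝ) => Φ (z + q.1 • u + r • V (z + q.2 • u))) ?_ 0
    exact hΦ.family ((hz.family.add (hu.family.smul (contDiff_fst.comp contDiff_fst))).add
      ((hVq.comp (contDiff_snd.comp contDiff_fst)).smul contDiff_snd))
  have h1 := deriv_diag (h := fun s q =>
    deriv (fun r : ℝ => Φ (z + s • u + r • V (z + q • u))) 0) hG
  have hy : SmoothHistory n (BoundaryPoisson.lieVec U V z) := (hU.lieVec hV).smoothHistory hz
  set y := BoundaryPoisson.lieVec U V z with hydef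
  have h2 : deriv (fun q : ℝ => deriv (fun r : ℝ => Φ (z + r • V (z + q • u))) 0) 0 =
      varDir Φ z y := by
    rw [deriv_deriv_comm (h := fun q r => Φ (z + r • V (z + q • u)))
      (hΦ.family (hz.family.add ((hVq.comp contDiff_fst).smul contDiff_snd)))]
    -- For fixed r the curve has velocity `r • y`. The derivative at r = 0 then falls on the
    -- explicit factor r alone.
    have h3 : ∀ r : ℝ, deriv (fun q : ℝ => Φ (z + r • V (z + q • u))) 0 =
        r • varDir Φ (z + r • V z) y := by
      intro r
      have hfam : SmoothFamily n (fun q : ℝ => z + r • V (z + q • u)) :=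
        hz.family.add (hVq.smul contDiff_const)
      have := hΦ.deriv_curve hfam (w := r • y) (fun t x => by
        have hd : HasDerivAt (fun q : ℝ => V (z + q • u) t x) (y t x) 0 :=
          ((smoothVariation_iff.1 hV).smoothFun t x).hasDerivAt hz hu
        exact ((hd.const_smul r).const_add (z t x)).deriv)
      rw [this]
      simp only [zero_smul, add_zero]
      exact hΦ.varDir_smul_right (hz.add (hv.const_smul r)) hy r
    simp_rw [h3]
    have hg : ContDiff ℝ ∞ (fun r : ℝ => varDir Φ (z + r • V z) y) := by
      refine contDiff_deriv_param (h := fun (r s : ℝ) => Φ (z + r • V z + s • y)) ?_ 0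
      exact hΦ.family ((hz.family.add (hv.family.smul contDiff_fst)).add
        (hy.family.smul contDiff_snd))
    have : HasDerivAt (fun r : ℝ => r • varDir Φ (z + r • V z) y) _ 0 :=
      (hasDerivAt_id (0 : ℝ)).smul (hg.differentiable (by simp) 0).hasDerivAt
    simpa using this.deriv
  simp only [zero_smul, add_zero] at h1
  rw [h2] at h1
  exact h1

/-- The commutator of derivations is the derivation along the commutator. -/
theorem SmoothFun.lie_bracket {Φ : History M ι → W} (hΦ : SmoothFun n Φ)
    {U V : History M ι → History M ι} (hU : SmoothVariation n U) (hV : SmoothVariation n V)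
    {z : History M ι} (hz : SmoothHistory n z) :
    BoundaryPoisson.lie (bracket U V) Φ z =
      BoundaryPoisson.lie U (BoundaryPoisson.lie V Φ) z -
        BoundaryPoisson.lie V (BoundaryPoisson.lie U Φ) z := by
  have hu := hU.smoothHistory hz
  have hv := hV.smoothHistory hz
  rw [hΦ.lie_lie hU hV hz, hΦ.lie_lie hV hU hz]
  have h1 : deriv (fun s : ℝ => deriv (fun r : ℝ => Φ (z + s • U z + r • V z)) 0) 0 =
      deriv (fun s : ℝ => deriv (fun r : ℝ => Φ (z + s • V z + r • U z)) 0) 0 := by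
    rw [deriv_deriv_comm (h := fun s r => Φ (z + s • U z + r • V z))
      (hΦ.family ((hz.family.add (hu.family.smul contDiff_fst)).add
        (hv.family.smul contDiff_snd)))]
    simp only [add_right_comm]
  rw [h1, add_sub_add_left_eq_sub]
  exact hΦ.varDir_sub_right hz ((hU.lieVec hV).smoothHistory hz) ((hV.lieVec hU).smoothHistory hz)

end Families

/-! ### Smooth volumes and the fundamental lemma of the calculus of variations. -/

section Volume

variable {n : ℕ} [NeZero n] {M : Type*} [TopologicalSpace M]
  [ChartedSpace (EuclideanHalfSpace n) M] {ι : Type*} [Fintype ι]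

/-- Even at a boundary point, a chart target lies in the closure of its interior. This yields both
density of interior points and positive volume of open sets. -/
theorem exists_isOpen_chart_subset {U : Set M} (hU : IsOpen U) {x : M} (hx : x ∈ U) :
    ∃ O : Set (EuclideanSpace ℝ (Fin n)), IsOpen O ∧ O.Nonempty ∧
      O ⊆ interior (extChartAt (𝓡∂ n) x).target ∧ ∀ y ∈ O, (extChartAt (𝓡∂ n) x).symm y ∈ U := by
  set φ := extChartAt (𝓡∂ n) x
  refine ⟨interior φ.target ∩ φ.symm ⁻¹' U, ?_, ?_, Set.inter_subset_left, fun y hy => hy.2⟩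
  · exact ((continuousOn_extChartAt_symm x).mono interior_subset).isOpen_inter_preimage
      isOpen_interior hU
  · have h1 : φ.symm ⁻¹' U ∈ 𝓝 (φ x) := extChartAt_preimage_mem_nhds (hU.mem_nhds hx)
    have h2 : φ x ∈ closure (interior φ.target) :=
      extChartAt_target_subset_closure_interior (mem_extChartAt_target x)
    obtain ⟨y, hy1, hy2⟩ := mem_closure_iff_nhds.1 h2 _ h1
    exact ⟨y, hy2, hy1⟩

theorem dense_interior [IsManifold (𝓡∂ n) ∞ M] : Dense ((𝓡∂ n).interior M) := by
  rw [dense_iff_inter_open]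
  rintro U hU ⟨x, hx⟩
  obtain ⟨O, -, ⟨y, hy⟩, hO, hOU⟩ := exists_isOpen_chart_subset (n := n) hU hx
  refine ⟨_, hOU y hy, ?_⟩
  have ht : y ∈ (extChartAt (𝓡∂ n) x).target := interior_subset (hO hy)
  have hs : (extChartAt (𝓡∂ n) x).symm y ∈ (chartAt (EuclideanHalfSpace n) x).source := by
    rw [← extChartAt_source (𝓡∂ n)]
    exact (extChartAt (𝓡∂ n) x).map_target ht
  refine ((𝓡∂ n).isInteriorPoint_iff_of_mem_atlas (n := ∞) (by simp)
    (chart_mem_atlas (EuclideanHalfSpace n) x) hs).2 ?_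
  change extChartAt (𝓡∂ n) x _ ∈ interior (extChartAt (𝓡∂ n) x).target
  rw [(extChartAt (𝓡∂ n) x).right_inv ht]
  exact hO hy

variable [MeasurableSpace M] [BorelSpace M] {μ : Measure M}

theorem IsSmoothVolume.isLocallyFiniteMeasure (hμ : IsSmoothVolume n μ) :
    IsLocallyFiniteMeasure μ := by
  refine ⟨fun p => ?_⟩
  obtain ⟨ρ, hρ, hpos, hmap⟩ := hμ p
  set φ := extChartAt (𝓡∂ n) p
  obtain ⟨ε, hε, hball⟩ :=
    Metric.mem_nhdsWithin_iff.1 (extChartAt_target_mem_nhdsWithin (I := 𝓡∂ n) p)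
  -- A compact (possibly cut) ball inside the chart target, on which the density is bounded.
  set C := Metric.closedBall (φ p) (ε / 2) ∩ Set.range (𝓡∂ n) with hCdef
  have hCt : C ⊆ φ.target := fun y hy => hball
    ⟨lt_of_le_of_lt (Metric.mem_closedBall.1 hy.1) (half_lt_self hε), hy.2⟩
  have hCc : IsCompact C := (isCompact_closedBall _ _).inter_right (𝓡∂ n).isClosed_range
  obtain ⟨B, hB⟩ := hCc.exists_bound_of_continuousOn (hρ.continuousOn.mono hCt)
  have hsrc : IsOpen φ.source := isOpen_extChartAt_source p
  have hφ : AEMeasurable φ (μ.restrict φ.source) :=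
    (continuousOn_extChartAt p).aemeasurable hsrc.measurableSet
  refine ⟨φ.source ∩ φ ⁻¹' Metric.ball (φ p) (ε / 2),
    (isOpen_extChartAt_preimage' p Metric.isOpen_ball).mem_nhds
      ⟨mem_extChartAt_source p, Metric.mem_ball_self (half_pos hε)⟩, ?_⟩
  calc μ (φ.source ∩ φ ⁻¹' Metric.ball (φ p) (ε / 2))
      ≤ μ (φ ⁻¹' C ∩ φ.source) := measure_mono fun x hx => ⟨⟨Metric.ball_subset_closedBall hx.2,
        extChartAt_target_subset_range p (φ.map_source hx.1)⟩, hx.1⟩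
    _ = μ.restrict φ.source (φ ⁻¹' C) := (Measure.restrict_apply' hsrc.measurableSet).symm
    _ ≤ (μ.restrict φ.source).map φ C := Measure.le_map_apply hφ C
    _ = ∫⁻ y in C, ENNReal.ofReal (ρ y) ∂(volume.restrict φ.target) := by
        rw [hmap, withDensity_apply _ hCc.measurableSet]
    _ ≤ ∫⁻ y in C, ENNReal.ofReal B ∂(volume.restrict φ.target) :=
        setLIntegral_mono' hCc.measurableSet fun y hy =>
          ENNReal.ofReal_le_ofReal ((le_abs_self _).trans (hB y hy))
    _ = ENNReal.ofReal B * (volume.restrict φ.target) C := setLIntegral_const _ _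
    _ < ⊤ := ENNReal.mul_lt_top ENNReal.ofReal_lt_top
        ((Measure.restrict_apply_le _ _).trans_lt hCc.measure_lt_top)

/-- An open set contains the chart image of a Euclidean closed ball of positive radius, on which the
continuous positive density has a positive minimum. -/
theorem IsSmoothVolume.isOpenPosMeasure (hμ : IsSmoothVolume n μ) : μ.IsOpenPosMeasure := by
  refine ⟨fun U hU ⟨x, hx⟩ => ?_⟩
  obtain ⟨ρ, hρ, hpos, hmap⟩ := hμ x
  obtain ⟨O, hO, ⟨y, hy⟩, hOt, hOU⟩ := exists_isOpen_chart_subset (n := n) hU hx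
  set φ := extChartAt (𝓡∂ n) x
  obtain ⟨ε, hε, hball⟩ := Metric.isOpen_iff.1 hO y hy
  set C := Metric.closedBall y (ε / 2)
  have hCO : C ⊆ O := (Metric.closedBall_subset_ball (half_lt_self hε)).trans hball
  have hCt : C ⊆ φ.target := hCO.trans (hOt.trans interior_subset)
  have hCc : IsCompact C := isCompact_closedBall _ _
  obtain ⟨y₀, hy₀, hmin⟩ := hCc.exists_isMinOn
    (Metric.nonempty_closedBall.2 (half_pos hε).le) (hρ.continuousOn.mono hCt)
  have hsrc : IsOpen φ.source := isOpen_extChartAt_source x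
  have hφ : AEMeasurable φ (μ.restrict φ.source) :=
    (continuousOn_extChartAt x).aemeasurable hsrc.measurableSet
  have h1 : 0 < (μ.restrict φ.source).map φ C := by
    rw [hmap, withDensity_apply _ hCc.measurableSet]
    calc 0 < ENNReal.ofReal (ρ y₀) * (volume.restrict φ.target) C := by
          refine ENNReal.mul_pos (by simpa using hpos _ (hCt hy₀)) ?_
          rw [Measure.restrict_eq_self _ hCt]
          exact (Metric.measure_closedBall_pos _ _ (half_pos hε)).ne'
      _ = ∫⁻ y in C, ENNReal.ofReal (ρ y₀) ∂(volume.restrict φ.target) :=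
          (setLIntegral_const _ _).symm
      _ ≤ _ := setLIntegral_mono' hCc.measurableSet fun y hy => ENNReal.ofReal_le_ofReal (hmin hy)
  rw [Measure.map_apply_of_aemeasurable hφ hCc.measurableSet,
    Measure.restrict_apply' hsrc.measurableSet] at h1
  refine (h1.trans_le (measure_mono fun x' hx' => ?_)).ne'
  have := hOU _ (hCO hx'.1)
  rwa [φ.left_inv hx'.2] at this

variable [T2Space M] [CompactSpace M]

theorem integrable_of_contMDiff [IsFiniteMeasureOnCompacts μ] {W : Type*} [NormedAddCommGroup W]
    [NormedSpace ℝ W] {f : M → W} (hf : ContMDiff (𝓡∂ n) 𝓘(ℝ, W) ∞ f) : Integrable f μ :=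
  hf.continuous.integrable_of_hasCompactSupport (HasCompactSupport.of_compactSpace f)

variable [SecondCountableTopology M] [IsManifold (𝓡∂ n) ∞ M]

/-- The fundamental lemma of the calculus of variations. -/
theorem IsSmoothVolume.eq_zero_of_pairing (hμ : IsSmoothVolume n μ) {u : Config M ι}
    (hu : SmoothConfig n u)
    (h : ∀ v, SmoothConfig n v → VanishesNearBoundary n v → pairing μ u v = 0) : u = 0 := by
  have := hμ.isLocallyFiniteMeasure
  have := hμ.isOpenPosMeasure
  by_contra hne
  obtain ⟨x₀, hx₀⟩ := Function.ne_iff.1 hne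
  have hucont : Continuous u := hu.continuous
  have hopen : IsOpen {x | u x ≠ 0} := isOpen_ne_fun hucont continuous_const
  -- If u is nonzero somewhere, it is so at an interior point. The test field is f u, with a cutoff
  -- f that is 1 there and vanishes near the boundary; its pairing with u is the integral of f |u|²,
  -- which is positive.
  obtain ⟨x₁, hx₁, hx₁'⟩ := (dense_interior (n := n) (M := M)).inter_open_nonempty _ hopen ⟨x₀, hx₀⟩
  obtain ⟨f, hf0, hf1, hf⟩ := exists_contMDiffMap_zero_one_nhds_of_isClosed (𝓡∂ n) (n := ⊤)
    ((𝓡∂ n).isClosed_boundary (M := M) (n := ∞) (by simp)) (isClosed_singleton (x := x₁))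
    (Set.disjoint_singleton_right.2 fun hb =>
      Set.disjoint_left.1 ((𝓡∂ n).disjoint_interior_boundary (M := M)) hx₁' hb)
  have hv : SmoothConfig n (fun x => f x • u x) := f.contMDiff.smul hu
  have hv0 : VanishesNearBoundary n (fun x => f x • u x) := fun x hx => by
    filter_upwards [eventually_nhdsSet_iff_forall.1 hf0 x hx] with y hy
    simp [hy]
  have hint := h _ hv hv0
  have hcont : Continuous fun x => u x ⬝ᵥ f x • u x :=
    contDiff_dotProduct.continuous.comp (hucont.prodMk hv.continuous)
  refine (hcont.integral_pos_of_hasCompactSupport_nonneg_nonzero (μ := μ) (x := x₁)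
    (HasCompactSupport.of_compactSpace _) (fun x => ?_) ?_).ne' hint
  · rw [dotProduct_smul]
    exact mul_nonneg (hf x).1 (by
      simp only [dotProduct]
      exact Finset.sum_nonneg fun i _ => mul_self_nonneg _)
  · have : f x₁ = 1 := by
      simpa using (eventually_nhdsSet_iff_forall.1 hf1 x₁ rfl).self_of_nhds
    rw [this, one_smul]
    exact fun h0 => hx₁ (dotProduct_self_eq_zero.1 h0)

end Volume

/-! ### Local functionals, pairings and variational derivatives. -/

section Functionals

variable {n : ℕ} [NeZero n] {M : Type*} [TopologicalSpace M]
  [ChartedSpace (EuclideanHalfSpace n) M] [IsManifold (𝓡∂ n) ∞ M] {ι : Type*} [Fintype ι]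
  [MeasurableSpace M] [BorelSpace M] [T2Space M] [CompactSpace M]
  {μ : Measure M} {W : Type*} [NormedAddCommGroup W] [NormedSpace ℝ W]

theorem SmoothObs.contMDiff {A : History M ι → ℝ → M → W} (hA : SmoothObs n A) {z : History M ι}
    (hz : SmoothHistory n z) (t : ℝ) : ContMDiff (𝓡∂ n) 𝓘(ℝ, W) ∞ (A z t) :=
  (hA.family (P := ℝ) hz.family).comp (f := fun x : M => ((0 : ℝ), (t, x)))
    (contMDiff_const.prodMk (contMDiff_const.prodMk contMDiff_id))

theorem SmoothObs.integral [IsFiniteMeasureOnCompacts μ] {A : History M ι → ℝ → M → W}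
    (hA : SmoothObs n A) (t : ℝ) : SmoothFun n (fun z => ∫ x, A z t x ∂μ) := fun p c hc => by
  have h := contMDiff_setIntegral (μ := μ) (K₀ := Set.univ) (I := 𝓘(ℝ, Fin p → ℝ)) (J := 𝓡∂ n)
    isCompact_univ (f := fun s x => A (c s) t x)
    ((hA p c hc).comp (f := fun q : (Fin p → ℝ) × M => (q.1, (t, q.2)))
      (contMDiff_fst.prodMk (contMDiff_const.prodMk contMDiff_snd)))
  simp only [Measure.restrict_univ] at h
  exact contMDiff_iff_contDiff.1 h

theorem SmoothObs.varDir_integral [IsFiniteMeasureOnCompacts μ] {A : History M ι → ℝ → M → W}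
    (hA : SmoothObs n A) (t : ℝ) {z v : History M ι} (hz : SmoothHistory n z)
    (hv : SmoothHistory n v) :
    varDir (fun z => ∫ x, A z t x ∂μ) z v = ∫ x, varDir (fun z => A z t x) z v ∂μ := by
  have hf : ContMDiff (𝓘(ℝ, ℝ).prod (𝓡∂ n)) 𝓘(ℝ, W) ∞
      (fun q : ℝ × M => A (z + q.1 • v) t q.2) :=
    (hA.family (hz.line hv)).comp (f := fun q : ℝ × M => (q.1, (t, q.2)))
      (contMDiff_fst.prodMk (contMDiff_const.prodMk contMDiff_snd))
  have hf' : ContMDiff (𝓘(ℝ, ℝ).prod (𝓡∂ n)) 𝓘(ℝ, ℝ →L[ℝ] W) ∞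
      (Function.uncurry fun (s : ℝ) (x : M) => fderiv ℝ (fun s : ℝ => A (z + s • v) t x) s) :=
    contMDiff_fderiv_param (N := ℝ × M) (g := fun q (s : ℝ) => A (z + s • v) t q.2)
      (r := Prod.fst) (hf.comp (f := fun q : (ℝ × M) × ℝ => (q.2, q.1.2))
        (contMDiff_snd.prodMk (contMDiff_snd.comp contMDiff_fst))) contMDiff_fst
  have h := hasFDerivWithinAt_setIntegral (μ := μ) (K₀ := Set.univ) (S := Set.univ)
    isCompact_univ convex_univ (f := fun (s : ℝ) x => A (z + s • v) t x)
    hf.continuous.continuousOn hf'.continuous.continuousOn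
    (fun s _ x => (((hA.smoothFun t x).contDiff_line hz hv).differentiable (by simp)
      s).hasFDerivAt.hasFDerivWithinAt) (y := 0) trivial
  rw [hasFDerivWithinAt_univ] at h
  simp only [Measure.restrict_univ] at h
  have h2 := h.hasDerivAt.deriv
  rw [ContinuousLinearMap.integral_apply] at h2
  · simp only [fderiv_apply_one_eq_deriv] at h2
    exact h2
  · exact integrable_of_contMDiff (n := n) (hf'.comp (f := fun x : M => ((0 : ℝ), x))
      (contMDiff_const.prodMk contMDiff_id))

theorem SmoothObs.dotProduct {A B : History M ι → ℝ → M → ι → ℝ} (hA : SmoothObs n A)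
    (hB : SmoothObs n B) : SmoothObs n (fun z t x => A z t x ⬝ᵥ B z t x) := fun p c hc =>
  contDiff_dotProduct.contMDiff.comp ((hA p c hc).prodMk_space (hB p c hc))

theorem SmoothFun.varDir_dotProduct {a b : History M ι → ι → ℝ} (ha : SmoothFun n a)
    (hb : SmoothFun n b) {z v : History M ι} (hz : SmoothHistory n z) (hv : SmoothHistory n v) :
    varDir (fun z => a z ⬝ᵥ b z) z v = varDir a z v ⬝ᵥ b z + a z ⬝ᵥ varDir b z v := by
  have h1 := ha.hasDerivAt hz hv
  have h2 := hb.hasDerivAt hz hv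
  rw [hasDerivAt_pi] at h1 h2
  have h3 : HasDerivAt (fun s : ℝ => a (z + s • v) ⬝ᵥ b (z + s • v))
      (∑ i, (varDir a z v i * b (z + (0 : ℝ) • v) i + a (z + (0 : ℝ) • v) i * varDir b z v i))
      0 := by
    simp only [_root_.dotProduct]
    exact HasDerivAt.fun_sum fun i _ => (h1 i).mul (h2 i)
  rw [zero_smul, add_zero, Finset.sum_add_distrib] at h3
  exact h3.deriv

theorem SmoothFun.congr {Φ Ψ : History M ι → W} (hΦ : SmoothFun n Φ)
    (h : ∀ z, SmoothHistory n z → Ψ z = Φ z) : SmoothFun n Ψ := fun p c hc => by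
  rw [show (fun s => Ψ (c s)) = fun s => Φ (c s) from funext fun s => h _ (hc.smoothHistory s)]
  exact hΦ p c hc

theorem pairing_add_right [IsFiniteMeasureOnCompacts μ] {u v w : Config M ι}
    (hu : SmoothConfig n u) (hv : SmoothConfig n v) (hw : SmoothConfig n w) :
    pairing μ u (v + w) = pairing μ u v + pairing μ u w := by
  simp only [pairing, Pi.add_apply, dotProduct_add]
  exact integral_add
    (integrable_of_contMDiff (n := n) (contDiff_dotProduct.contMDiff.comp (hu.prodMk_space hv)))
    (integrable_of_contMDiff (n := n) (contDiff_dotProduct.contMDiff.comp (hu.prodMk_space hw)))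

theorem pairing_comm (u v : Config M ι) : pairing μ u v = pairing μ v u := by
  simp only [pairing, dotProduct_comm]

theorem pairing_smul_right (u v : Config M ι) (a : ℝ) :
    pairing μ u (a • v) = a * pairing μ u v := by
  simp only [pairing, Pi.smul_apply, dotProduct_smul, smul_eq_mul, integral_const_mul]

theorem pairing_sub_right [IsFiniteMeasureOnCompacts μ] {u v w : Config M ι}
    (hu : SmoothConfig n u) (hv : SmoothConfig n v) (hw : SmoothConfig n w) :
    pairing μ u (v - w) = pairing μ u v - pairing μ u w := by
  have := pairing_add_right (μ := μ) hu (hv.sub hw) hw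
  rw [sub_add_cancel] at this
  rw [this, add_sub_cancel_right]

theorem SmoothObs.pairing [IsFiniteMeasureOnCompacts μ] {A B : History M ι → ℝ → M → ι → ℝ}
    (hA : SmoothObs n A) (hB : SmoothObs n B) (t : ℝ) :
    SmoothFun n (fun z => pairing μ (A z t) (B z t)) :=
  (hA.dotProduct hB).integral t

/-- The Leibniz rule for the pairing. -/
theorem SmoothObs.lie_pairing [IsFiniteMeasureOnCompacts μ] {A B : History M ι → ℝ → M → ι → ℝ}
    (hA : SmoothObs n A) (hB : SmoothObs n B) (t : ℝ) {U : History M ι → History M ι}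
    (hU : SmoothVariation n U) {z : History M ι} (hz : SmoothHistory n z) :
    BoundaryPoisson.lie U (fun z => BoundaryPoisson.pairing μ (A z t) (B z t)) z =
      BoundaryPoisson.pairing μ (fun x => BoundaryPoisson.lie U (fun z => A z t x) z) (B z t) +
        BoundaryPoisson.pairing μ (A z t)
          (fun x => BoundaryPoisson.lie U (fun z => B z t x) z) := by
  have hu := hU.smoothHistory hz
  refine ((hA.dotProduct hB).varDir_integral (μ := μ) t hz hu).trans ?_
  simp_rw [(hA.smoothFun t _).varDir_dotProduct (hB.smoothFun t _) hz hu]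
  exact integral_add
    (integrable_of_contMDiff (n := n) (((hA.lie hU).dotProduct hB).contMDiff hz t))
    (integrable_of_contMDiff (n := n) ((hA.dotProduct (hB.lie hU)).contMDiff hz t))

/-! ### Local functionals -/

theorem IsLocalFunctional.smoothFun [IsFiniteMeasureOnCompacts μ] {F : ℝ → Config M ι → ℝ}
    (hF : IsLocalFunctional n μ F) (t : ℝ) : SmoothFun n (fun z : History M ι => F t (z t)) := by
  obtain ⟨f, hf, h⟩ := hF
  exact (hf.smoothObs.integral t).congr fun z hz => h t _ (hz.config t)

theorem IsLocalFunctional.add [IsFiniteMeasureOnCompacts μ] {F G : ℝ → Config M ι → ℝ}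
    (hF : IsLocalFunctional n μ F) (hG : IsLocalFunctional n μ G) :
    IsLocalFunctional n μ (F + G) := by
  obtain ⟨f, hf, hF⟩ := hF
  obtain ⟨g, hg, hG⟩ := hG
  refine ⟨_, hf.add hg, fun t z hz => ?_⟩
  rw [integral_add (integrable_of_contMDiff (n := n) (hf.contMDiff t hz))
    (integrable_of_contMDiff (n := n) (hg.contMDiff t hz)), ← hF t z hz, ← hG t z hz]
  rfl

theorem IsLocalFunctional.const_smul {F : ℝ → Config M ι → ℝ}
    (hF : IsLocalFunctional n μ F) (a : ℝ) : IsLocalFunctional n μ (a • F) := by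
  obtain ⟨f, hf, hF⟩ := hF
  refine ⟨_, hf.const_smul a, fun t z hz => ?_⟩
  rw [integral_smul, ← hF t z hz]
  rfl

theorem IsLocalFunctional.sub [IsFiniteMeasureOnCompacts μ] {F G : ℝ → Config M ι → ℝ}
    (hF : IsLocalFunctional n μ F) (hG : IsLocalFunctional n μ G) :
    IsLocalFunctional n μ (F - G) := by
  have := hF.add (hG.const_smul (-1))
  rwa [neg_one_smul, ← sub_eq_add_neg] at this

theorem IsLocalFunctional.zero : IsLocalFunctional n μ (0 : ℝ → Config M ι → ℝ) :=
  ⟨_, isLocalOp_const (0 : ℝ), fun t z hz => by simp⟩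

theorem isLocalFunctional_pairing {E U : ℝ → Config M ι → Config M ι} (hE : IsLocalOp n E)
    (hU : IsLocalOp n U) : IsLocalFunctional n μ (fun t z => pairing μ (E t z) (U t z)) :=
  ⟨_, hE.dotProduct hU, fun _ _ _ => rfl⟩

theorem IsLocalFunctional.firstVar [IsFiniteMeasureOnCompacts μ] {F : ℝ → Config M ι → ℝ}
    (hF : IsLocalFunctional n μ F) {U : ℝ → Config M ι → Config M ι} (hU : IsLocalOp n U) :
    IsLocalFunctional n μ (fun t z => firstVar (F t) z (U t z)) := by
  obtain ⟨f, hf, hF⟩ := hF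
  refine ⟨_, hf.deriv hU, fun t z hz => ?_⟩
  have hu := hU.smoothConfig t hz
  -- A configuration is treated as a time independent history, so that the calculus on histories
  -- applies.
  calc BoundaryPoisson.firstVar (F t) z (U t z)
      = varDir (fun z : History M ι => F t (z t)) (fun _ => z) (fun _ => U t z) := rfl
    _ = varDir (fun z : History M ι => ∫ x, f t (z t) x ∂μ) (fun _ => z) (fun _ => U t z) :=
        varDir_congr (fun z hz => hF t _ (hz.config t)) hz.history hu.history
    _ = _ := hf.smoothObs.varDir_integral t hz.history hu.history

theorem IsLocalFunctional.firstVar_add [IsFiniteMeasureOnCompacts μ] {F G : ℝ → Config M ι → ℝ}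
    (hF : IsLocalFunctional n μ F) (hG : IsLocalFunctional n μ G) (t : ℝ) {z v : Config M ι}
    (hz : SmoothConfig n z) (hv : SmoothConfig n v) :
    BoundaryPoisson.firstVar ((F + G) t) z v =
      BoundaryPoisson.firstVar (F t) z v + BoundaryPoisson.firstVar (G t) z v :=
  (hF.smoothFun t).varDir_add (hG.smoothFun t) hz.history hv.history

theorem firstVar_const_smul (F : ℝ → Config M ι → ℝ) (a t : ℝ) (z v : Config M ι) :
    firstVar ((a • F) t) z v = a * firstVar (F t) z v := by
  simp [firstVar]

/-! ### The variational derivative -/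

variable [SecondCountableTopology M]

theorem IsVarDeriv.unique (hμ : IsSmoothVolume n μ) {F : ℝ → Config M ι → ℝ}
    {E E' : ℝ → Config M ι → Config M ι} (h : IsVarDeriv n μ F E) (h' : IsVarDeriv n μ F E')
    (t : ℝ) {z : Config M ι} (hz : SmoothConfig n z) : E t z = E' t z := by
  have := hμ.isLocallyFiniteMeasure
  have hE := h.1.smoothConfig t hz
  have hE' := h'.1.smoothConfig t hz
  refine sub_eq_zero.1 (hμ.eq_zero_of_pairing (hE.sub hE') fun v hv hv0 => ?_)
  rw [pairing_comm, pairing_sub_right hv hE hE', pairing_comm v, pairing_comm v,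
    ← h.2 t z v hz hv hv0, ← h'.2 t z v hz hv hv0, sub_self]

theorem isVarDeriv_varDeriv {F : ℝ → Config M ι → ℝ} (h : ∃ E, IsVarDeriv n μ F E) :
    IsVarDeriv n μ F (varDeriv n μ F) := by
  rw [varDeriv, dif_pos h]
  exact h.choose_spec

/-- The default value 0 is local too, so X_F is a smooth vector field for every F, with no existence
assumption. -/
theorem isLocalOp_varDeriv (F : ℝ → Config M ι → ℝ) : IsLocalOp n (varDeriv n μ F) := by
  by_cases h : ∃ E, IsVarDeriv n μ F E
  · exact (isVarDeriv_varDeriv h).1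
  · rw [varDeriv, dif_neg h]
    exact isLocalOp_const 0

theorem IsVarDeriv.varDeriv_eq (hμ : IsSmoothVolume n μ) {F : ℝ → Config M ι → ℝ}
    {E : ℝ → Config M ι → Config M ι} (h : IsVarDeriv n μ F E) (t : ℝ) {z : Config M ι}
    (hz : SmoothConfig n z) : varDeriv n μ F t z = E t z :=
  (isVarDeriv_varDeriv ⟨E, h⟩).unique hμ h t hz

end Functionals

/-! ### The Jacobi identity for derivations on the space of histories. -/

section Derivations

variable {n : ℕ} [NeZero n] {M : Type*} [TopologicalSpace M]
  [ChartedSpace (EuclideanHalfSpace n) M] [IsManifold (𝓡∂ n) ∞ M] {ι : Type*} [Fintype ι]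
  {Φ : History M ι → ℝ} {z : History M ι}

theorem SmoothFun.lie_lie_bracket (hΦ : SmoothFun n Φ) {U V Y : History M ι → History M ι}
    (hU : SmoothVariation n U) (hV : SmoothVariation n V) (hY : SmoothVariation n Y)
    (hz : SmoothHistory n z) :
    BoundaryPoisson.lie Y (BoundaryPoisson.lie (bracket U V) Φ) z =
      BoundaryPoisson.lie Y (BoundaryPoisson.lie U (BoundaryPoisson.lie V Φ)) z -
        BoundaryPoisson.lie Y (BoundaryPoisson.lie V (BoundaryPoisson.lie U Φ)) z := by
  have hy := hY.smoothHistory hz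
  exact (varDir_congr (fun z hz => hΦ.lie_bracket hU hV hz) hz hy).trans
    (((hΦ.lie hV).lie hU).varDir_sub ((hΦ.lie hU).lie hV) hz hy)

/-- The Jacobi identity for vector fields on the space of histories. -/
theorem SmoothFun.lie_jacobi (hΦ : SmoothFun n Φ) {U V Y : History M ι → History M ι}
    (hU : SmoothVariation n U) (hV : SmoothVariation n V) (hY : SmoothVariation n Y)
    (hz : SmoothHistory n z) :
    BoundaryPoisson.lie Y (BoundaryPoisson.lie (bracket U V) Φ) z -
        BoundaryPoisson.lie (bracket U V) (BoundaryPoisson.lie Y Φ) z =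
      (BoundaryPoisson.lie (bracket Y U) (BoundaryPoisson.lie V Φ) z -
        BoundaryPoisson.lie V (BoundaryPoisson.lie (bracket Y U) Φ) z) -
      (BoundaryPoisson.lie (bracket Y V) (BoundaryPoisson.lie U Φ) z -
        BoundaryPoisson.lie U (BoundaryPoisson.lie (bracket Y V) Φ) z) := by
  -- Every bracket is expanded into triple derivatives of Φ along U, V, Y, which cancel formally.
  rw [hΦ.lie_lie_bracket hU hV hY hz, hΦ.lie_lie_bracket hY hU hV hz,
    hΦ.lie_lie_bracket hY hV hU hz, (hΦ.lie hY).lie_bracket hU hV hz,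
    (hΦ.lie hV).lie_bracket hY hU hz, (hΦ.lie hU).lie_bracket hY hV hz]
  ring

theorem SmoothFun.varDir_const_smul (hΦ : SmoothFun n Φ) (a : ℝ) {v : History M ι}
    (hz : SmoothHistory n z) (hv : SmoothHistory n v) :
    varDir (fun z => a * Φ z) z v = a * varDir Φ z v :=
  ((hΦ.hasDerivAt hz hv).const_mul a).deriv

theorem SmoothFun.const_smul (hΦ : SmoothFun n Φ) (a : ℝ) : SmoothFun n (fun z => a * Φ z) :=
  fun p c hc => contDiff_const.mul (hΦ p c hc)

theorem SmoothFun.varDir_linear (hΦ : SmoothFun n Φ) (a b : ℝ) {v w : History M ι}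
    (hz : SmoothHistory n z) (hv : SmoothHistory n v) (hw : SmoothHistory n w) :
    varDir Φ z (a • v + b • w) = a * varDir Φ z v + b * varDir Φ z w := by
  rw [hΦ.varDir_add_right hz (hv.const_smul a) (hw.const_smul b), hΦ.varDir_smul_right hz hv,
    hΦ.varDir_smul_right hz hw, smul_eq_mul, smul_eq_mul]

theorem smoothVariation_const {v : History M ι} (hv : SmoothHistory n v) :
    SmoothVariation n (fun _ => v) := fun _ _ _ => hv.family

end Derivations

/-! ### The modified bracket: its variational derivative, vector field and Jacobi identity. -/

namespace FieldTheory

variable {n : ℕ} [NeZero n] {M : Type*} [TopologicalSpace M] [T2Space M]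
  [SecondCountableTopology M] [CompactSpace M]
  [ChartedSpace (EuclideanHalfSpace n) M] [IsManifold (𝓡∂ n) ∞ M]
  [MeasurableSpace M] [BorelSpace M]
  {ι : Type*} [Fintype ι] [DecidableEq ι] {κ : Type*} (T : FieldTheory n M ι κ)

instance : IsLocallyFiniteMeasure T.vol := T.smooth_vol.isLocallyFiniteMeasure

/-! ### Hamiltonian transformations -/

theorem isLocalOp_ham (F : ℝ → Config M ι → ℝ) : IsLocalOp n (T.ham F) :=
  (isLocalOp_varDeriv F).comp_contDiff (contDiff_mulVec T.σ)

theorem smoothVariation_hamHist (F : ℝ → Config M ι → ℝ) : SmoothVariation n (T.hamHist F) :=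
  (T.isLocalOp_ham F).smoothObs

theorem smoothObs_varDeriv (F : ℝ → Config M ι → ℝ) :
    SmoothObs n (fun z t x => varDeriv n T.vol F t (z t) x) :=
  (isLocalOp_varDeriv F).smoothObs

theorem smoothObs_chiI (α : κ) : SmoothObs n (T.chiI α) :=
  (T.χ_local α).smoothObs

theorem smoothObs_chiE (α : κ) (k : ℕ) : SmoothObs n (T.chiE α k) := by
  induction k with
  | zero => exact T.smoothObs_chiI α
  | succ k ih =>
    exact ih.totalTime.sub (ih.partialTime.add (ih.lie (T.smoothVariation_hamHist T.H)))

theorem pairing_mulVec (u v : Config M ι) :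
    pairing T.vol u (fun x => T.σ *ᵥ v x) = -pairing T.vol v (fun x => T.σ *ᵥ u x) := by
  simp only [pairing, ← integral_neg]
  congr 1
  funext x
  rw [Matrix.dotProduct_mulVec, ← Matrix.mulVec_transpose, T.σ_antisymm, Matrix.neg_mulVec,
    neg_dotProduct, dotProduct_comm]

/-- The bulk parts of the two boundary terms contribute -2{F, G} by antisymmetry of σ, against the
explicit +{F, G}. -/
theorem modBracket_eq (F G : ℝ → Config M ι → ℝ) (t : ℝ) (z : Config M ι) :
    T.modBracket F G t z = firstVar (F t) z (T.ham G t z) - firstVar (G t) z (T.ham F t z) -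
      pairing T.vol (varDeriv n T.vol F t z) (T.ham G t z) := by
  have : pairing T.vol (varDeriv n T.vol G t z) (T.ham F t z) =
      -pairing T.vol (varDeriv n T.vol F t z) (T.ham G t z) := T.pairing_mulVec _ _
  rw [modBracket, poisson, boundaryTerm, boundaryTerm, this]
  ring

theorem modBracket_antisymm (F G : ℝ → Config M ι → ℝ) (t : ℝ) (z : Config M ι) :
    T.modBracket F G t z = -T.modBracket G F t z := by
  have : pairing T.vol (varDeriv n T.vol G t z) (T.ham F t z) =
      -pairing T.vol (varDeriv n T.vol F t z) (T.ham G t z) := T.pairing_mulVec _ _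
  rw [modBracket_eq, modBracket_eq, this]
  ring

theorem isLocalFunctional_modBracket {F G : ℝ → Config M ι → ℝ}
    (hF : IsLocalFunctional n T.vol F) (hG : IsLocalFunctional n T.vol G) :
    IsLocalFunctional n T.vol (T.modBracket F G) := by
  have h := ((hF.firstVar (T.isLocalOp_ham G)).sub (hG.firstVar (T.isLocalOp_ham F))).sub
    (isLocalFunctional_pairing (μ := T.vol) (isLocalOp_varDeriv (μ := T.vol) F)
      (T.isLocalOp_ham G))
  convert h using 1
  funext t z
  exact T.modBracket_eq F G t z

/-- The functional `F` at time `t`, as a function of the histories. -/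
def atTime (F : ℝ → Config M ι → ℝ) (t : ℝ) : History M ι → ℝ := fun z => F t (z t)

theorem atTime_modBracket (F G : ℝ → Config M ι → ℝ) (t : ℝ) :
    atTime (T.modBracket F G) t = fun z => lie (T.hamHist G) (atTime F t) z -
      lie (T.hamHist F) (atTime G t) z -
      pairing T.vol (varDeriv n T.vol F t (z t)) (T.hamHist G z t) :=
  funext fun z => T.modBracket_eq F G t (z t)

theorem lieVec_hamHist (F : ℝ → Config M ι → ℝ) {U : History M ι → History M ι}
    (hU : SmoothVariation n U) {z : History M ι} (hz : SmoothHistory n z) (t : ℝ) :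
    lieVec U (T.hamHist F) z t =
      fun x => T.σ *ᵥ lie U (fun z => varDeriv n T.vol F t (z t) x) z := by
  funext x
  have h := ((T.smoothObs_varDeriv F).smoothFun t x).hasDerivAt hz (hU.smoothHistory hz)
  exact ((Matrix.mulVecLin T.σ).toContinuousLinearMap.hasFDerivAt.comp_hasDerivAt (0 : ℝ) h).deriv

/-- The variational derivative of the modified bracket. -/
def brVarDeriv (F G : ℝ → Config M ι → ℝ) : ℝ → Config M ι → Config M ι :=
  fun t z x => deriv (fun s : ℝ => varDeriv n T.vol F t (z + s • T.ham G t z) x) 0 -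
    deriv (fun s : ℝ => varDeriv n T.vol G t (z + s • T.ham F t z) x) 0

theorem isLocalOp_brVarDeriv (F G : ℝ → Config M ι → ℝ) : IsLocalOp n (T.brVarDeriv F G) :=
  ((isLocalOp_varDeriv F).deriv (T.isLocalOp_ham G)).sub
    ((isLocalOp_varDeriv G).deriv (T.isLocalOp_ham F))

/-- Commute δ past U and apply Leibniz; the terms ⟨E_F, U(δz)⟩ cancel. The variational formula
enters only through `h₁` and `h₂`, so the lemma serves both test variations at arbitrary z and
boundary preserving variations on C. -/
theorem lie_lie_atTime {F : ℝ → Config M ι → ℝ} (hF : IsLocalFunctional n T.vol F)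
    {δ U : History M ι → History M ι} (hδ : SmoothVariation n δ) (hU : SmoothVariation n U)
    {z : History M ι} (hz : SmoothHistory n z) (t : ℝ)
    (h₁ : lie U (lie δ (atTime F t)) z =
      lie U (fun z => pairing T.vol (varDeriv n T.vol F t (z t)) (δ z t)) z)
    (h₂ : lie (bracket δ U) (atTime F t) z =
      pairing T.vol (varDeriv n T.vol F t (z t)) (bracket δ U z t)) :
    lie δ (lie U (atTime F t)) z =
      pairing T.vol (fun x => lie U (fun z => varDeriv n T.vol F t (z t) x) z) (δ z t) +
        pairing T.vol (varDeriv n T.vol F t (z t)) (lieVec δ U z t) := by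
  have h3 := (hF.smoothFun t).lie_bracket hδ hU hz
  have h4 : pairing T.vol (varDeriv n T.vol F t (z t)) (bracket δ U z t) =
      pairing T.vol (varDeriv n T.vol F t (z t)) (lieVec δ U z t) -
        pairing T.vol (varDeriv n T.vol F t (z t)) (lieVec U δ z t) :=
    pairing_sub_right ((isLocalOp_varDeriv F).smoothConfig t (hz.config t))
      (((hδ.lieVec hU).smoothHistory hz).config t) (((hU.lieVec hδ).smoothHistory hz).config t)
  have h5 := (T.smoothObs_varDeriv F).lie_pairing (μ := T.vol) (smoothVariation_iff.1 hδ) t hU hz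
  change lie (bracket δ U) (atTime F t) z =
    lie δ (lie U (atTime F t)) z - lie U (lie δ (atTime F t)) z at h3
  change _ = _ + pairing T.vol (varDeriv n T.vol F t (z t)) (lieVec U δ z t) at h5
  rw [h₁, h5, h₂, h4] at h3
  linarith

/-- After `lie_lie_atTime` for F and G, the surplus is ⟨E_F, δX_G⟩ - ⟨E_G, δX_F⟩. By antisymmetry of
σ it equals δ⟨E_F, X_G⟩, which the last term of `modBracket_eq` subtracts. -/
theorem firstVar_modBracket {F G : ℝ → Config M ι → ℝ} (hF : IsLocalFunctional n T.vol F)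
    (hG : IsLocalFunctional n T.vol G) {δ : History M ι → History M ι}
    (hδ : SmoothVariation n δ) {z : History M ι} (hz : SmoothHistory n z) (t : ℝ)
    (hF₁ : lie (T.hamHist G) (lie δ (atTime F t)) z =
      lie (T.hamHist G) (fun z => pairing T.vol (varDeriv n T.vol F t (z t)) (δ z t)) z)
    (hF₂ : lie (bracket δ (T.hamHist G)) (atTime F t) z =
      pairing T.vol (varDeriv n T.vol F t (z t)) (bracket δ (T.hamHist G) z t))
    (hG₁ : lie (T.hamHist F) (lie δ (atTime G t)) z =
      lie (T.hamHist F) (fun z => pairing T.vol (varDeriv n T.vol G t (z t)) (δ z t)) z)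
    (hG₂ : lie (bracket δ (T.hamHist F)) (atTime G t) z =
      pairing T.vol (varDeriv n T.vol G t (z t)) (bracket δ (T.hamHist F) z t)) :
    firstVar (T.modBracket F G t) (z t) (δ z t) =
      pairing T.vol (T.brVarDeriv F G t (z t)) (δ z t) := by
  have hXF := T.smoothVariation_hamHist F
  have hXG := T.smoothVariation_hamHist G
  have hv := hδ.smoothHistory hz
  have e1 := T.lie_lie_atTime hF hδ hXG hz t hF₁ hF₂
  have e2 := T.lie_lie_atTime hG hδ hXF hz t hG₁ hG₂
  have e3 := (T.smoothObs_varDeriv F).lie_pairing (μ := T.vol) (smoothVariation_iff.1 hXG) t hδ hz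
  change _ = _ + pairing T.vol (varDeriv n T.vol F t (z t)) (lieVec δ (T.hamHist G) z t) at e3
  have e4 : pairing T.vol (varDeriv n T.vol G t (z t)) (lieVec δ (T.hamHist F) z t) =
      -pairing T.vol (fun x => lie δ (fun z => varDeriv n T.vol F t (z t) x) z)
        (T.hamHist G z t) := by
    rw [T.lieVec_hamHist F hδ hz t, T.pairing_mulVec]
    rfl
  have e5 : firstVar (T.modBracket F G t) (z t) (δ z t) =
      lie δ (lie (T.hamHist G) (atTime F t)) z - lie δ (lie (T.hamHist F) (atTime G t)) z -
        lie δ (fun z => pairing T.vol (varDeriv n T.vol F t (z t)) (T.hamHist G z t)) z := by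
    change varDir (atTime (T.modBracket F G) t) z (δ z) = _
    rw [T.atTime_modBracket]
    have s1 : SmoothFun n (lie (T.hamHist G) (atTime F t)) := SmoothFun.lie (hF.smoothFun t) hXG
    have s2 : SmoothFun n (lie (T.hamHist F) (atTime G t)) := SmoothFun.lie (hG.smoothFun t) hXF
    have s3 := (T.smoothObs_varDeriv F).pairing (μ := T.vol) (smoothVariation_iff.1 hXG) t
    rw [(s1.sub s2).varDir_sub s3 hz hv, s1.varDir_sub s2 hz hv]
    rfl
  have e6 : pairing T.vol (T.brVarDeriv F G t (z t)) (δ z t) =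
      pairing T.vol (fun x => lie (T.hamHist G) (fun z => varDeriv n T.vol F t (z t) x) z)
        (δ z t) -
      pairing T.vol (fun x => lie (T.hamHist F) (fun z => varDeriv n T.vol G t (z t) x) z)
        (δ z t) := by
    rw [pairing_comm, pairing_comm _ (δ z t), pairing_comm _ (δ z t)]
    exact pairing_sub_right (hv.config t)
      (((T.smoothObs_varDeriv F).lie hXG).contMDiff hz t)
      (((T.smoothObs_varDeriv G).lie hXF).contMDiff hz t)
  rw [e5, e1, e2, e3, e4, e6]
  ring

/-- Apply `firstVar_modBracket` to the constant vector field v. Its bracket with a Hamiltonian field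
is the variation of that field along v, which by locality still vanishes near the boundary, so the
defining property of E applies to it. -/
theorem isVarDeriv_modBracket {F G : ℝ → Config M ι → ℝ} (hF : IsLocalFunctional n T.vol F)
    (hG : IsLocalFunctional n T.vol G) (hF' : ∃ E, IsVarDeriv n T.vol F E)
    (hG' : ∃ E, IsVarDeriv n T.vol G E) :
    IsVarDeriv n T.vol (T.modBracket F G) (T.brVarDeriv F G) := by
  refine ⟨T.isLocalOp_brVarDeriv F G, fun t z v hz hv hv0 => ?_⟩
  have hδ : SmoothVariation n (fun _ _ => v : History M ι → History M ι) :=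
    smoothVariation_const hv.history
  have h1 : ∀ {K : ℝ → Config M ι → ℝ} (_ : ∃ E, IsVarDeriv n T.vol K E)
      (K' : ℝ → Config M ι → ℝ),
      lie (T.hamHist K') (lie (fun _ _ => v) (atTime K t)) (fun _ => z) =
      lie (T.hamHist K') (fun z => pairing T.vol (varDeriv n T.vol K t (z t)) v)
        (fun _ => z) := fun hK K' =>
    varDir_congr (fun z' hz' => (isVarDeriv_varDeriv hK).2 t (z' t) v (hz'.config t) hv hv0)
      hz.history ((T.smoothVariation_hamHist K').smoothHistory hz.history)
  have h2 : ∀ {K : ℝ → Config M ι → ℝ} (_ : ∃ E, IsVarDeriv n T.vol K E)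
      (K' : ℝ → Config M ι → ℝ),
      lie (bracket (fun _ _ => v) (T.hamHist K')) (atTime K t) (fun _ => z) =
      pairing T.vol (varDeriv n T.vol K t z)
        (bracket (fun _ _ => v) (T.hamHist K') (fun _ => z) t) := fun hK K' => by
    refine (isVarDeriv_varDeriv hK).2 t z _ hz
      (((hδ.bracket (T.smoothVariation_hamHist K')).smoothHistory hz.history).config t)
      fun x hx => ?_
    filter_upwards [(T.isLocalOp_ham K').deriv_eventually_zero t hz hv (hv0 x hx)] with y hy
    change deriv (fun s : ℝ => T.ham K' t (z + s • v) y) 0 - deriv (fun _ : ℝ => v y) 0 = 0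
    rw [hy, deriv_const, sub_zero]
  exact T.firstVar_modBracket hF hG hδ hz.history t (h1 hF' G) (h2 hF' G) (h1 hG' F) (h2 hG' F)

/-- Apply σ to X_G E_F - X_F E_G; being constant, σ commutes with the derivations. Note the reversed
order in the bracket. -/
theorem hamHist_modBracket {F G : ℝ → Config M ι → ℝ} (hF : IsLocalFunctional n T.vol F)
    (hG : IsLocalFunctional n T.vol G) (hF' : ∃ E, IsVarDeriv n T.vol F E)
    (hG' : ∃ E, IsVarDeriv n T.vol G E) {z : History M ι} (hz : SmoothHistory n z) :
    T.hamHist (T.modBracket F G) z = bracket (T.hamHist G) (T.hamHist F) z := by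
  funext t
  have h1 := (T.isVarDeriv_modBracket hF hG hF' hG').varDeriv_eq T.smooth_vol t (hz.config t)
  change (fun x => T.σ *ᵥ varDeriv n T.vol (T.modBracket F G) t (z t) x) =
    lieVec (T.hamHist G) (T.hamHist F) z t - lieVec (T.hamHist F) (T.hamHist G) z t
  rw [h1, T.lieVec_hamHist F (T.smoothVariation_hamHist G) hz t,
    T.lieVec_hamHist G (T.smoothVariation_hamHist F) hz t]
  funext x
  exact Matrix.mulVec_sub _ _ _

theorem lie_hamHist_modBracket {F G : ℝ → Config M ι → ℝ} (hF : IsLocalFunctional n T.vol F)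
    (hG : IsLocalFunctional n T.vol G) (hF' : ∃ E, IsVarDeriv n T.vol F E)
    (hG' : ∃ E, IsVarDeriv n T.vol G E) (Φ : History M ι → ℝ) {z : History M ι}
    (hz : SmoothHistory n z) :
    lie (T.hamHist (T.modBracket F G)) Φ z = lie (bracket (T.hamHist G) (T.hamHist F)) Φ z :=
  congrArg (varDir Φ z) (T.hamHist_modBracket hF hG hF' hG' hz)

/-- Leibniz rule, with the derivative of E_F moved onto X_F through σ, so that only derivatives of
vector fields remain. -/
theorem lie_pairing_hamHist (F G : ℝ → Config M ι → ℝ) {U : History M ι → History M ι}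
    (hU : SmoothVariation n U) {z : History M ι} (hz : SmoothHistory n z) (t : ℝ) :
    lie U (fun z => pairing T.vol (varDeriv n T.vol F t (z t)) (T.hamHist G z t)) z =
      pairing T.vol (varDeriv n T.vol F t (z t)) (lieVec U (T.hamHist G) z t) -
        pairing T.vol (varDeriv n T.vol G t (z t)) (lieVec U (T.hamHist F) z t) := by
  have e3 := (T.smoothObs_varDeriv F).lie_pairing (μ := T.vol)
    (smoothVariation_iff.1 (T.smoothVariation_hamHist G)) t hU hz
  have e4 : pairing T.vol (varDeriv n T.vol G t (z t)) (lieVec U (T.hamHist F) z t) =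
      -pairing T.vol (fun x => lie U (fun z => varDeriv n T.vol F t (z t) x) z)
        (T.hamHist G z t) := by
    rw [T.lieVec_hamHist F hU hz t, T.pairing_mulVec]
    rfl
  rw [e3, e4, sub_neg_eq_add, add_comm]
  rfl

/-- A normal form made of second derivatives of functionals and pairings with derivatives of vector
fields, valid at every smooth z and chosen so that its cyclic sum cancels formally. -/
theorem modBracket_modBracket {F G K : ℝ → Config M ι → ℝ} (hF : IsLocalFunctional n T.vol F)
    (hG : IsLocalFunctional n T.vol G) (hK : IsLocalFunctional n T.vol K)
    (hG' : ∃ E, IsVarDeriv n T.vol G E)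
    (hK' : ∃ E, IsVarDeriv n T.vol K E) {z : History M ι} (hz : SmoothHistory n z) (t : ℝ) :
    T.modBracket F (T.modBracket G K) t (z t) =
      lie (T.hamHist K) (lie (T.hamHist G) (atTime F t)) z
        - lie (T.hamHist G) (lie (T.hamHist K) (atTime F t)) z
        - lie (T.hamHist F) (lie (T.hamHist K) (atTime G t)) z
        + lie (T.hamHist F) (lie (T.hamHist G) (atTime K t)) z
        + pairing T.vol (varDeriv n T.vol G t (z t)) (lieVec (T.hamHist F) (T.hamHist K) z t)
        - pairing T.vol (varDeriv n T.vol K t (z t)) (lieVec (T.hamHist F) (T.hamHist G) z t)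
        - pairing T.vol (varDeriv n T.vol F t (z t)) (lieVec (T.hamHist K) (T.hamHist G) z t)
        + pairing T.vol (varDeriv n T.vol F t (z t))
            (lieVec (T.hamHist G) (T.hamHist K) z t) := by
  have hXF := T.smoothVariation_hamHist F
  have hXG := T.smoothVariation_hamHist G
  have hXK := T.smoothVariation_hamHist K
  have e0 : T.modBracket F (T.modBracket G K) t (z t) =
      lie (T.hamHist (T.modBracket G K)) (atTime F t) z -
        lie (T.hamHist F) (atTime (T.modBracket G K) t) z -
        pairing T.vol (varDeriv n T.vol F t (z t)) (T.hamHist (T.modBracket G K) z t) :=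
    T.modBracket_eq F _ t (z t)
  rw [T.lie_hamHist_modBracket hG hK hG' hK' _ hz, T.hamHist_modBracket hG hK hG' hK' hz,
    T.atTime_modBracket G K t] at e0
  have e1 : lie (bracket (T.hamHist K) (T.hamHist G)) (atTime F t) z =
      lie (T.hamHist K) (lie (T.hamHist G) (atTime F t)) z -
        lie (T.hamHist G) (lie (T.hamHist K) (atTime F t)) z :=
    SmoothFun.lie_bracket (hF.smoothFun t) hXK hXG hz
  have s1 : SmoothFun n (lie (T.hamHist K) (atTime G t)) := SmoothFun.lie (hG.smoothFun t) hXK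
  have s2 : SmoothFun n (lie (T.hamHist G) (atTime K t)) := SmoothFun.lie (hK.smoothFun t) hXG
  have s3 := (T.smoothObs_varDeriv G).pairing (μ := T.vol) (smoothVariation_iff.1 hXK) t
  have hv := hXF.smoothHistory hz
  have e2 : lie (T.hamHist F) (fun z => lie (T.hamHist K) (atTime G t) z -
      lie (T.hamHist G) (atTime K t) z -
      pairing T.vol (varDeriv n T.vol G t (z t)) (T.hamHist K z t)) z =
      lie (T.hamHist F) (lie (T.hamHist K) (atTime G t)) z -
        lie (T.hamHist F) (lie (T.hamHist G) (atTime K t)) z -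
        lie (T.hamHist F)
          (fun z => pairing T.vol (varDeriv n T.vol G t (z t)) (T.hamHist K z t)) z :=
    ((s1.sub s2).varDir_sub s3 hz hv).trans
      (congrArg (fun r => r - _) (s1.varDir_sub s2 hz hv))
  have e3 : pairing T.vol (varDeriv n T.vol F t (z t))
      (bracket (T.hamHist K) (T.hamHist G) z t) =
      pairing T.vol (varDeriv n T.vol F t (z t)) (lieVec (T.hamHist K) (T.hamHist G) z t) -
      pairing T.vol (varDeriv n T.vol F t (z t)) (lieVec (T.hamHist G) (T.hamHist K) z t) :=
    pairing_sub_right ((isLocalOp_varDeriv F).smoothConfig t (hz.config t))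
      (((hXK.lieVec hXG).smoothHistory hz).config t)
      (((hXG.lieVec hXK).smoothHistory hz).config t)
  rw [e1, e2, e3, T.lie_pairing_hamHist G K hXF hz t] at e0
  refine e0.trans ?_
  ring

/-- The Jacobi identity for the modified bracket. -/
theorem modBracket_jacobi {F G K : ℝ → Config M ι → ℝ} (hF : IsLocalFunctional n T.vol F)
    (hG : IsLocalFunctional n T.vol G) (hK : IsLocalFunctional n T.vol K)
    (hF' : ∃ E, IsVarDeriv n T.vol F E) (hG' : ∃ E, IsVarDeriv n T.vol G E)
    (hK' : ∃ E, IsVarDeriv n T.vol K E) (t : ℝ) {z : Config M ι} (hz : SmoothConfig n z) :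
    T.modBracket F (T.modBracket G K) t z + T.modBracket G (T.modBracket K F) t z
      + T.modBracket K (T.modBracket F G) t z = 0 := by
  have h1 := T.modBracket_modBracket hF hG hK hG' hK' hz.history t
  have h2 := T.modBracket_modBracket hG hK hF hK' hF' hz.history t
  have h3 := T.modBracket_modBracket hK hF hG hF' hG' hz.history t
  -- The twelve second derivatives and the twelve pairings cancel in pairs.
  rw [h1, h2, h3]
  ring

end FieldTheory

/-! ### Generalized differentiable functionals -/

namespace FieldTheory

variable {n : ℕ} [NeZero n] {M : Type*} [TopologicalSpace M] [T2Space M]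
  [SecondCountableTopology M] [CompactSpace M]
  [ChartedSpace (EuclideanHalfSpace n) M] [IsManifold (𝓡∂ n) ∞ M] [MeasurableSpace M]
  [BorelSpace M] {ι : Type*} [Fintype ι] [DecidableEq ι] {κ : Type*} {T : FieldTheory n M ι κ}

/-- Under regularity of the external boundary conditions, variations preserving them are tangent
to the space of histories satisfying them. -/
theorem RegularExternal.lie_congr (hreg : T.RegularExternal) {U : History M ι → History M ι}
    (hU : SmoothVariation n U) (hUE : T.PreservesExternal U) {Φ Ψ : History M ι → ℝ}
    (hΦ : SmoothFun n Φ) (hΨ : SmoothFun n Ψ) (h : ∀ z, T.Allowed z → Φ z = Ψ z)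
    {z : History M ι} (hz : T.Allowed z) : lie U Φ z = lie U Ψ z := by
  -- Φ and Ψ agree along a curve inside C with velocity U(z), and derivatives along curves see only
  -- the velocity.
  obtain ⟨c, hc, hc0, hcA, hcw⟩ := hreg z hz (U z) (hU.smoothHistory hz.1) (hUE z hz)
  have h1 := hΦ.deriv_curve hc hcw
  have h2 := hΨ.deriv_curve hc hcw
  rw [hc0] at h1 h2
  rw [lie, lie, ← h1, ← h2]
  congr 1
  exact funext fun s => h _ (hcA s)

theorem RegularExternal.lie_eq_zero (hreg : T.RegularExternal) {U : History M ι → History M ι}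
    (hU : SmoothVariation n U) (hUE : T.PreservesExternal U) {Φ : History M ι → ℝ}
    (hΦ : SmoothFun n Φ) (h : ∀ z, T.Allowed z → Φ z = 0)
    {z : History M ι} (hz : T.Allowed z) : lie U Φ z = 0 :=
  (hreg.lie_congr hU hUE hΦ (Ψ := fun _ => 0) (fun _ _ _ => contDiff_const) h hz).trans
    (deriv_const _ _)

/-- V χ_E vanishes on C at the boundary and U is tangent to C, so U V χ_E vanishes there; likewise
with U and V exchanged. -/
theorem PreservesExternal.bracket (hreg : T.RegularExternal) {U V : History M ι → History M ι}
    (hU : SmoothVariation n U) (hUE : T.PreservesExternal U) (hV : SmoothVariation n V)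
    (hVE : T.PreservesExternal V) : T.PreservesExternal (bracket U V) :=
  fun z hz k hk α t x hx => by
  have hχ := (T.smoothObs_chiE α k).smoothFun t x
  refine (hχ.lie_bracket hU hV hz.1).trans ?_
  rw [hreg.lie_eq_zero hU hUE (hχ.lie hV) (fun z hz => hVE z hz k hk α t x hx) hz,
    hreg.lie_eq_zero hV hVE (hχ.lie hU) (fun z hz => hUE z hz k hk α t x hx) hz, sub_zero]

/-- This is the role of the commutator condition: [δ, X_G] is again an admissible variation, to
which the defining conditions of another functional can be applied. -/
theorem PreservesInternal.bracket (hreg : T.RegularExternal) {δ : History M ι → History M ι}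
    (hδ : SmoothVariation n δ) (hδI : T.PreservesInternal δ) {G : ℝ → Config M ι → ℝ}
    (hG : T.GenDiff G) : T.PreservesInternal (BoundaryPoisson.bracket δ (T.hamHist G)) :=
  ⟨PreservesExternal.bracket hreg hδ hδI.1 (T.smoothVariation_hamHist G) hG.preservesExternal,
    fun z hz α t x hx => (((T.smoothObs_chiI α).smoothFun t x).lie_bracket hδ
      (T.smoothVariation_hamHist G) hz.1).trans (hG.commutator δ hδ hδI z hz α t x hx)⟩

/-- The boundary term of a generalized differentiable functional depends on a variation through
the variation of the sources only. -/
theorem GenDiff.boundaryTerm_congr {F : ℝ → Config M ι → ℝ} (hF : T.GenDiff F)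
    {δ δ' : History M ι → History M ι} (hδ : SmoothVariation n δ) (hδ' : SmoothVariation n δ')
    (hδE : T.PreservesExternal δ) (hδE' : T.PreservesExternal δ')
    (h : ∀ z, T.Allowed z → ∀ α, ∀ t, ∀ x ∈ (𝓡∂ n).boundary M,
      varObs δ (T.chiI α) z t x = varObs δ' (T.chiI α) z t x)
    {z : History M ι} (hz : T.Allowed z) (t : ℝ) :
    T.boundaryTerm F t (z t) (δ z t) = T.boundaryTerm F t (z t) (δ' z t) := by
  have key : T.PreservesInternal (fun z => δ z - δ' z) := by
    refine ⟨fun z hz k hk α t x hx => ?_, fun z hz α t x hx => ?_⟩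
    · refine (((T.smoothObs_chiE α k).smoothFun t x).varDir_sub_right hz.1
        (hδ.smoothHistory hz.1) (hδ'.smoothHistory hz.1)).trans ?_
      exact sub_eq_zero.2 ((hδE z hz k hk α t x hx).trans (hδE' z hz k hk α t x hx).symm)
    · refine (((T.smoothObs_chiI α).smoothFun t x).varDir_sub_right hz.1
        (hδ.smoothHistory hz.1) (hδ'.smoothHistory hz.1)).trans ?_
      exact sub_eq_zero.2 (h z hz α t x hx)
  have h1 := hF.variation _ (hδ.sub hδ') key z hz t
  have h2 : firstVar (F t) (z t) (δ z t - δ' z t) =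
      firstVar (F t) (z t) (δ z t) - firstVar (F t) (z t) (δ' z t) :=
    (hF.isLocal.smoothFun t).varDir_sub_right hz.1 (hδ.smoothHistory hz.1)
      (hδ'.smoothHistory hz.1)
  have h3 := pairing_sub_right (μ := T.vol)
    ((isLocalOp_varDeriv (μ := T.vol) F).smoothConfig t (hz.1.config t))
    ((hδ.smoothHistory hz.1).config t) ((hδ'.smoothHistory hz.1).config t)
  have h4 : firstVar (F t) (z t) (δ z t - δ' z t) =
    pairing T.vol (varDeriv n T.vol F t (z t)) (δ z t - δ' z t) := h1
  rw [h2, h3] at h4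
  rw [boundaryTerm, boundaryTerm]
  linarith

/-- The modified bracket of generalized differentiable functionals is one. -/
theorem GenDiff.modBracket (hreg : T.RegularExternal) {F G : ℝ → Config M ι → ℝ}
    (hF : T.GenDiff F) (hG : T.GenDiff G) : T.GenDiff (T.modBracket F G) := by
  have hXF := T.smoothVariation_hamHist F
  have hXG := T.smoothVariation_hamHist G
  have hE := T.isVarDeriv_modBracket hF.isLocal hG.isLocal hF.hasVarDeriv hG.hasVarDeriv
  have hX := fun (Φ : History M ι → ℝ) {z : History M ι} (hz : SmoothHistory n z) =>
    T.lie_hamHist_modBracket hF.isLocal hG.isLocal hF.hasVarDeriv hG.hasVarDeriv Φ hz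
  have hb : T.PreservesExternal (bracket (T.hamHist G) (T.hamHist F)) :=
    PreservesExternal.bracket hreg hXG hG.preservesExternal hXF hF.preservesExternal
  -- The formula δK = ⟨E_K, δz⟩ is known on C only; tangency of the vector field of `K'` allows
  -- differentiating it.
  have tangent : ∀ {K : ℝ → Config M ι → ℝ} (_ : T.GenDiff K) {K' : ℝ → Config M ι → ℝ}
      (_ : T.GenDiff K') {δ : History M ι → History M ι} (_ : SmoothVariation n δ)
      (_ : T.PreservesInternal δ) {z : History M ι} (_ : T.Allowed z) (t : ℝ),
      lie (T.hamHist K') (lie δ (atTime K t)) z =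
        lie (T.hamHist K') (fun z => pairing T.vol (varDeriv n T.vol K t (z t)) (δ z t)) z :=
    fun {K} hK {K'} hK' {δ} hδ hδI {z} hz t =>
      hreg.lie_congr (T.smoothVariation_hamHist K') hK'.preservesExternal
        (SmoothFun.lie (hK.isLocal.smoothFun t) hδ)
        ((T.smoothObs_varDeriv K).pairing (smoothVariation_iff.1 hδ) t)
        (fun z hz => hK.variation δ hδ hδI z hz t) hz
  refine ⟨T.isLocalFunctional_modBracket hF.isLocal hG.isLocal, ⟨_, hE⟩,
    fun δ hδ hδI z hz t => ?_, fun z hz k hk α t x hx => ?_, fun δ hδ hδI z hz α t x hx => ?_⟩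
  · rw [hE.varDeriv_eq T.smooth_vol t (hz.1.config t)]
    exact T.firstVar_modBracket hF.isLocal hG.isLocal hδ hz.1 t
      (tangent hF hG hδ hδI hz t)
      (hF.variation _ (hδ.bracket hXG) (PreservesInternal.bracket hreg hδ hδI hG) z hz t)
      (tangent hG hF hδ hδI hz t)
      (hG.variation _ (hδ.bracket hXF) (PreservesInternal.bracket hreg hδ hδI hF) z hz t)
  · exact (hX (fun z => T.chiE α k z t x) hz.1).trans (hb z hz k hk α t x hx)
  · have hχ := (T.smoothObs_chiI α).smoothFun t x
    have h1 : lie δ (lie (T.hamHist (T.modBracket F G)) fun z => T.chiI α z t x) z =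
        lie δ (lie (bracket (T.hamHist G) (T.hamHist F)) fun z => T.chiI α z t x) z :=
      varDir_congr (fun z hz => hX _ hz) hz.1 (hδ.smoothHistory hz.1)
    have h2 := hF.commutator _ (hδ.bracket hXG) (PreservesInternal.bracket hreg hδ hδI hG)
      z hz α t x hx
    have h3 := hG.commutator _ (hδ.bracket hXF) (PreservesInternal.bracket hreg hδ hδI hF)
      z hz α t x hx
    -- [δ, [X_G, X_F]] = [[δ, X_G], X_F] - [[δ, X_F], X_G] on χ_I, where each term vanishes by a
    -- commutator condition for the admissible variations [δ, X_G] and [δ, X_F].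
    have h4 := hχ.lie_jacobi hXG hXF hδ hz.1
    refine (congrArg₂ (· - ·) h1 (hX (lie δ fun z => T.chiI α z t x) hz.1)).trans (h4.trans ?_)
    exact (congrArg₂ (· - ·) h2 h3).trans (sub_zero 0)

/-! ### Linearity -/

theorem isVarDeriv_linear {F G : ℝ → Config M ι → ℝ} (hF : IsLocalFunctional n T.vol F)
    (hG : IsLocalFunctional n T.vol G) (hF' : ∃ E, IsVarDeriv n T.vol F E)
    (hG' : ∃ E, IsVarDeriv n T.vol G E) (a b : ℝ) :
    IsVarDeriv n T.vol (a • F + b • G)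
      (fun t z => a • varDeriv n T.vol F t z + b • varDeriv n T.vol G t z) := by
  have hEF := isLocalOp_varDeriv (n := n) (μ := T.vol) F
  have hEG := isLocalOp_varDeriv (n := n) (μ := T.vol) G
  refine ⟨(hEF.const_smul a).add (hEG.const_smul b), fun t z v hz hv hv0 => ?_⟩
  rw [(hF.const_smul a).firstVar_add (hG.const_smul b) t hz hv, firstVar_const_smul,
    firstVar_const_smul, (isVarDeriv_varDeriv hF').2 t z v hz hv hv0,
    (isVarDeriv_varDeriv hG').2 t z v hz hv hv0, pairing_comm _ v, pairing_comm _ v,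
    pairing_comm _ v, ← pairing_smul_right, ← pairing_smul_right]
  exact (pairing_add_right hv ((hEF.smoothConfig t hz).const_smul a)
    ((hEG.smoothConfig t hz).const_smul b)).symm

/-- Linearity comes from uniqueness of variational derivatives, hence the restriction to smooth z.
-/
theorem ham_linear {F G : ℝ → Config M ι → ℝ} (hF : IsLocalFunctional n T.vol F)
    (hG : IsLocalFunctional n T.vol G) (hF' : ∃ E, IsVarDeriv n T.vol F E)
    (hG' : ∃ E, IsVarDeriv n T.vol G E) (a b t : ℝ) {z : Config M ι} (hz : SmoothConfig n z) :
    T.ham (a • F + b • G) t z = a • T.ham F t z + b • T.ham G t z := by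
  funext x
  rw [ham, (isVarDeriv_linear hF hG hF' hG' a b).varDeriv_eq T.smooth_vol t hz]
  change T.σ *ᵥ (a • varDeriv n T.vol F t z x + b • varDeriv n T.vol G t z x) = _
  rw [Matrix.mulVec_add, Matrix.mulVec_smul, Matrix.mulVec_smul]
  rfl

theorem firstVar_linear_right {K : ℝ → Config M ι → ℝ} (hK : IsLocalFunctional n T.vol K)
    (a b t : ℝ) {z v w : Config M ι} (hz : SmoothConfig n z) (hv : SmoothConfig n v)
    (hw : SmoothConfig n w) :
    firstVar (K t) z (a • v + b • w) = a * firstVar (K t) z v + b * firstVar (K t) z w :=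
  (hK.smoothFun t).varDir_linear a b hz.history hv.history hw.history

theorem modBracket_linear {F G K : ℝ → Config M ι → ℝ} (hF : IsLocalFunctional n T.vol F)
    (hG : IsLocalFunctional n T.vol G) (hK : IsLocalFunctional n T.vol K)
    (hF' : ∃ E, IsVarDeriv n T.vol F E) (hG' : ∃ E, IsVarDeriv n T.vol G E)
    (a b t : ℝ) {z : Config M ι} (hz : SmoothConfig n z) :
    T.modBracket (a • F + b • G) K t z = a * T.modBracket F K t z + b * T.modBracket G K t z := by
  have hu := (T.isLocalOp_ham K).smoothConfig t hz
  have e1 : pairing T.vol (a • varDeriv n T.vol F t z + b • varDeriv n T.vol G t z)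
      (T.ham K t z) = a * pairing T.vol (varDeriv n T.vol F t z) (T.ham K t z) +
        b * pairing T.vol (varDeriv n T.vol G t z) (T.ham K t z) := by
    rw [pairing_comm, pairing_add_right hu
      (((isLocalOp_varDeriv F).smoothConfig t hz).const_smul a)
      (((isLocalOp_varDeriv G).smoothConfig t hz).const_smul b), pairing_smul_right,
      pairing_smul_right, pairing_comm (T.ham K t z), pairing_comm (T.ham K t z)]
  rw [modBracket_eq, modBracket_eq, modBracket_eq,
    (isVarDeriv_linear hF hG hF' hG' a b).varDeriv_eq T.smooth_vol t hz, e1,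
    ham_linear hF hG hF' hG' a b t hz, (hF.const_smul a).firstVar_add (hG.const_smul b) t hz hu,
    firstVar_const_smul, firstVar_const_smul,
    firstVar_linear_right hK a b t hz ((T.isLocalOp_ham F).smoothConfig t hz)
      ((T.isLocalOp_ham G).smoothConfig t hz)]
  ring

theorem GenDiff.linear {F G : ℝ → Config M ι → ℝ} (hF : T.GenDiff F) (hG : T.GenDiff G)
    (a b : ℝ) : T.GenDiff (a • F + b • G) := by
  have hXF := T.smoothVariation_hamHist F
  have hXG := T.smoothVariation_hamHist G
  have hE := isVarDeriv_linear hF.isLocal hG.isLocal hF.hasVarDeriv hG.hasVarDeriv a b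
  have hX : ∀ {Φ : History M ι → ℝ} (_ : SmoothFun n Φ) {z : History M ι}
      (_ : SmoothHistory n z), lie (T.hamHist (a • F + b • G)) Φ z =
        a * lie (T.hamHist F) Φ z + b * lie (T.hamHist G) Φ z := fun {Φ} hΦ z hz => by
    have h : T.hamHist (a • F + b • G) z = a • T.hamHist F z + b • T.hamHist G z :=
      funext fun t => ham_linear hF.isLocal hG.isLocal hF.hasVarDeriv hG.hasVarDeriv a b t
        (hz.config t)
    rw [lie, h]
    exact hΦ.varDir_linear a b hz (hXF.smoothHistory hz) (hXG.smoothHistory hz)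
  refine ⟨(hF.isLocal.const_smul a).add (hG.isLocal.const_smul b), ⟨_, hE⟩,
    fun δ hδ hδI z hz t => ?_, fun z hz k hk α t x hx => ?_, fun δ hδ hδI z hz α t x hx => ?_⟩
  · have hv := (hδ.smoothHistory hz.1).config t
    rw [hE.varDeriv_eq T.smooth_vol t (hz.1.config t),
      (hF.isLocal.const_smul a).firstVar_add (hG.isLocal.const_smul b) t (hz.1.config t) hv,
      firstVar_const_smul, firstVar_const_smul, hF.variation δ hδ hδI z hz t,
      hG.variation δ hδ hδI z hz t, pairing_comm _ (δ z t), pairing_comm _ (δ z t),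
      pairing_comm _ (δ z t), ← pairing_smul_right, ← pairing_smul_right]
    exact (pairing_add_right hv
      (((isLocalOp_varDeriv F).smoothConfig t (hz.1.config t)).const_smul a)
      (((isLocalOp_varDeriv G).smoothConfig t (hz.1.config t)).const_smul b)).symm
  · have h1 : lie (T.hamHist F) (fun z => T.chiE α k z t x) z = 0 :=
      hF.preservesExternal z hz k hk α t x hx
    have h2 : lie (T.hamHist G) (fun z => T.chiE α k z t x) z = 0 :=
      hG.preservesExternal z hz k hk α t x hx
    refine (hX ((T.smoothObs_chiE α k).smoothFun t x) hz.1).trans ?_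
    rw [h1, h2, mul_zero, mul_zero, add_zero]
  · have hχ := (T.smoothObs_chiI α).smoothFun t x
    have hv := hδ.smoothHistory hz.1
    have h1 : lie δ (lie (T.hamHist (a • F + b • G)) fun z => T.chiI α z t x) z =
        a * lie δ (lie (T.hamHist F) fun z => T.chiI α z t x) z +
          b * lie δ (lie (T.hamHist G) fun z => T.chiI α z t x) z := by
      refine (varDir_congr (fun z hz => hX hχ hz) hz.1 hv).trans ?_
      refine (((hχ.lie hXF).const_smul a).varDir_add ((hχ.lie hXG).const_smul b) hz.1 hv).trans ?_
      rw [(hχ.lie hXF).varDir_const_smul a hz.1 hv, (hχ.lie hXG).varDir_const_smul b hz.1 hv]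
      rfl
    have h2 : lie δ (lie (T.hamHist F) fun z => T.chiI α z t x) z -
        lie (T.hamHist F) (lie δ fun z => T.chiI α z t x) z = 0 :=
      hF.commutator δ hδ hδI z hz α t x hx
    have h3 : lie δ (lie (T.hamHist G) fun z => T.chiI α z t x) z -
        lie (T.hamHist G) (lie δ fun z => T.chiI α z t x) z = 0 :=
      hG.commutator δ hδ hδI z hz α t x hx
    refine (congrArg₂ (· - ·) h1 (hX (hχ.lie hδ) hz.1)).trans ?_
    linear_combination a * h2 + b * h3

variable (T) in
theorem genDiff_zero : T.GenDiff 0 := by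
  have hE : IsVarDeriv n T.vol (0 : ℝ → Config M ι → ℝ) 0 :=
    ⟨isLocalOp_const 0, fun t z v _ _ _ => by simp [firstVar, pairing]⟩
  have hX : ∀ (Φ : History M ι → ℝ) {z : History M ι} (_ : SmoothHistory n z),
      lie (T.hamHist 0) Φ z = 0 := fun Φ z hz => by
    have h : T.hamHist 0 z = 0 := by
      funext t x
      rw [hamHist, ham, hE.varDeriv_eq T.smooth_vol t (hz.config t)]
      exact Matrix.mulVec_zero _
    simp [lie, h, varDir]
  refine ⟨IsLocalFunctional.zero, ⟨_, hE⟩, fun δ _ _ z hz t => ?_,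
    fun z hz k _ α t x _ => hX (fun z => T.chiE α k z t x) hz.1, fun δ hδ hδI z hz α t x hx => ?_⟩
  · rw [hE.varDeriv_eq T.smooth_vol t (hz.1.config t)]
    simp [firstVar, pairing]
  · have h1 : lie δ (lie (T.hamHist 0) fun z => T.chiI α z t x) z = 0 :=
      (varDir_congr (fun z hz => hX _ hz) hz.1 (hδ.smoothHistory hz.1)).trans (deriv_const _ _)
    exact (congrArg₂ (· - ·) h1 (hX (lie δ fun z => T.chiI α z t x) hz.1)).trans (sub_zero 0)

end FieldTheory

end BoundaryPoisson

end

theorem mainTheorem3 {n : ℕ} [NeZero n] {M : Type*} [TopologicalSpace M] [T2Space M]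
    [SecondCountableTopology M] [CompactSpace M]
    [ChartedSpace (EuclideanHalfSpace n) M] [IsManifold (𝓡∂ n) ∞ M]
    [MeasurableSpace M] [BorelSpace M]
    {ι : Type*} [Fintype ι] [DecidableEq ι] {κ : Type*}
    (T : BoundaryPoisson.FieldTheory n M ι κ) (hreg : T.RegularExternal) :
    -- the boundary terms only depend on the variation of the sources
    (∀ F, T.GenDiff F → ∀ δ δ', BoundaryPoisson.SmoothVariation n δ →
      BoundaryPoisson.SmoothVariation n δ' → T.PreservesExternal δ → T.PreservesExternal δ' →
      (∀ z, T.Allowed z → ∀ α, ∀ t, ∀ x ∈ (𝓡∂ n).boundary M,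
        BoundaryPoisson.varObs δ (T.chiI α) z t x = BoundaryPoisson.varObs δ' (T.chiI α) z t x) →
      ∀ z, T.Allowed z → ∀ t,
        T.boundaryTerm F t (z t) (δ z t) = T.boundaryTerm F t (z t) (δ' z t)) ∧
    -- the bracket of generalized differentiable functionals is one
    (∀ F G, T.GenDiff F → T.GenDiff G → T.GenDiff (T.modBracket F G)) ∧
    -- linear structure and bilinearity (with antisymmetry)
    T.GenDiff 0 ∧
    (∀ F G K, T.GenDiff F → T.GenDiff G → T.GenDiff K → ∀ a b : ℝ,
      T.GenDiff (a • F + b • G) ∧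
      ∀ t z, BoundaryPoisson.SmoothConfig n z → T.modBracket (a • F + b • G) K t z =
        a * T.modBracket F K t z + b * T.modBracket G K t z) ∧
    -- antisymmetry
    (∀ F G, T.GenDiff F → T.GenDiff G → ∀ t z, BoundaryPoisson.SmoothConfig n z →
      T.modBracket F G t z = - T.modBracket G F t z) ∧
    -- Jacobi identity
    (∀ F G K, T.GenDiff F → T.GenDiff G → T.GenDiff K →
      ∀ t z, BoundaryPoisson.SmoothConfig n z →
        T.modBracket F (T.modBracket G K) t z + T.modBracket G (T.modBracket K F) t z
          + T.modBracket K (T.modBracket F G) t z = 0) := by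
  refine ⟨fun F hF δ δ' hδ hδ' hE hE' h z hz t => hF.boundaryTerm_congr hδ hδ' hE hE' h hz t,
    fun F G hF hG => BoundaryPoisson.FieldTheory.GenDiff.modBracket hreg hF hG, T.genDiff_zero,
    fun F G K hF hG hK a b => ⟨hF.linear hG a b, fun t z hz =>
      BoundaryPoisson.FieldTheory.modBracket_linear hF.isLocal hG.isLocal hK.isLocal
        hF.hasVarDeriv hG.hasVarDeriv a b t hz⟩,
    fun F G _ _ t z _ => T.modBracket_antisymm F G t z,
    fun F G K hF hG hK t z hz => T.modBracket_jacobi hF.isLocal hG.isLocal hK.isLocal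
      hF.hasVarDeriv hG.hasVarDeriv hK.hasVarDeriv t hz⟩
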